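/- Let $N\ge 1$ and $\vec\kappa=(\kappa_0,\kappa_1,\kappa_\infty,\theta_1,\dots,\theta_N)\in\mathbb C^{N+3}$, and put $\alpha(\vec\kappa)=\alpha=-\tfrac12\bigl(\kappa_0+\kappa_1+\kappa_\infty+\sum_i\theta_i-1\bigr)$, $R_{ij}=\frac{s_i(s_j-1)}{s_j-s_i}$, $S_{ij}=\frac{s_i(s_i-1)}{s_i-s_j}$. Define $H_i=H_i(q,p,s;\vec\kappa)$, $1\le i\le N$, by $$\begin{aligned} s_i(s_i-1)H_i={}&q_i\Bigl(\alpha+\sum_jq_jp_j\Bigr)\Bigl(\alpha+\kappa_\infty+\sum_jq_jp_j\Bigr)+s_ip_i(q_ip_i-\theta_i)\\ &-\sum_{j\ne i}R_{ji}(q_jp_j-\theta_j)q_ip_j-\sum_{j\ne i}S_{ij}(q_ip_i-\theta_i)q_jp_i\\ &-\sum_{j\ne i}R_{ij}q_jp_j(q_ip_i-\theta_i)-\sum_{j\ne i}R_{ij}q_ip_i(q_jp_j-\theta_j)\\ &-(s_i+1)(q_ip_i-\theta_i)q_ip_i+(\kappa_1s_i+\kappa_0-1)q_ip_i . \end{aligned}$$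 The Garnier system $\mathcal H_N(\vec\kappa)$ is $\partial q_i/\partial s_j=\partial H_j/\partial p_i$, $\partial p_i/\partial s_j=-\partial H_j/\partial q_i$ $(i,j=1,\dots,N)$. Consider the following birational transformations $(\vec\kappa,q,p)\mapsto(\vec\kappa',Q,P)$, which fix $s$; parameters and variables that are not mentioned are unchanged. - $R_{\kappa_\infty}$: $\kappa_\infty\mapsto-\kappa_\infty$. - $R_{\kappa_1}$: $\kappa_1\mapsto-\kappa_1$, $P_i=p_i-\dfrac{\kappa_1}{\sum_jq_j-1}$. - $R_{\kappa_0}$: $\kappa_0\mapsto-\kappa_0$, $P_i=p_i-\dfrac{\kappa_0}{s_i(\sum_jq_j/s_j-1)}$. - $R_{\theta_j}$: $\theta_j\mapsto-\theta_j$, $P_j=p_j-\theta_j/q_j$. - $R_\tau$: $\vec\kappa\mapsto(1-\kappa_0,1-\kappa_1,-\kappa_\infty,-\theta_1,\dots,-\theta_N)$, $Q_i=\dfrac{s_ip_i(q_ip_i-\theta_i)}{(\alpha+\sum_jq_jp_j)(\alpha+\kappa_\infty+\sum_jq_jp_j)}$, $Q_iP_i=-q_ip_i$. Let $l=R_{\kappa_1}\circ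 R_\tau\circ R_{\theta_1}\circ\cdots\circ R_{\theta_N}\circ R_{\kappa_\infty}\circ R_{\kappa_0}$ (the rightmost map is applied first), so that $l(\vec\kappa)=\vec\kappa+(1,-1,0,\dots,0)$. For fixed $s$ and $\vec\kappa$ let $l^{\pm1}(H_i)=H_i\bigl(l^{\pm1}(q),l^{\pm1}(p),s;l^{\pm1}(\vec\kappa)\bigr)$, a rational function of $(q,p)$. Let $(q(s),p(s))$ be a holomorphic solution of $\mathcal H_N(\vec\kappa)$ on an open set $U\subset\{s\in\mathbb C^N: s_i\ne0,1,\ s_i\ne s_j\ (i\ne j)\}$. Let $H_i(s)$ and $H_i^{\pm}(s)$ be the values of $H_i$ and of $l^{\pm1}(H_i)$ at $(q(s),p(s))$, and put $$F(s)=\Bigl(\sum_j(s_j-1)\frac{\partial}{\partial s_j}-1\Bigr)\sum_ks_k(s_k-1)H_k(s)-\kappa_1(\kappa_0-1)+\alpha(\alpha+\kappa_\infty).$$ Then $H_1(s),\dots,H_N(s)$ and $F(s)$ are holomorphic on $U$, and for every $i$ and every $s\in U$ with $F(s)\neq0$ at which the rational functions $l(H_i)$ and $l^{-1}(H_i)$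 are regular at $(q(s),p(s))$, $$H_i^+(s)-2H_i(s)+H_i^-(s)=\frac{\partial}{\partial s_i}\log F(s)=\frac{1}{F(s)}\frac{\partial F}{\partial s_i}(s).$$ -/

import Mathlib

namespace Garnier

noncomputable section

/-- The parameter vector `(κ₀, κ₁, κ_∞, θ₁, …, θ_N)`. -/
@[ext] structure Params (N : ℕ) where
  κ0 : ℂ
  κ1 : ℂ
  κinf : ℂ
  θ : Fin N → ℂ

/-- `α = -(κ₀ + κ₁ + κ_∞ + ∑ θ_i - 1) / 2`. -/
def Params.α {N : ℕ} (k : Params N) : ℂ :=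
  -(k.κ0 + k.κ1 + k.κinf + ∑ i, k.θ i - 1) / 2

/-- `R_{ij} = s_i (s_j - 1) / (s_j - s_i)`. -/
def coefR {N : ℕ} (s : Fin N → ℂ) (i j : Fin N) : ℂ := s i * (s j - 1) / (s j - s i)

/-- `S_{ij} = s_i (s_i - 1) / (s_i - s_j)`. -/
def coefS {N : ℕ} (s : Fin N → ℂ) (i j : Fin N) : ℂ := s i * (s i - 1) / (s i - s j)

/-- The Hamiltonian `H_i(q, p, s; κ)`. The canonical variables `q, p` have values in a field
extension `K` of `ℂ`: `K = ℂ` for the values along a solution, `K = ℂ(q, p)` for the rational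
functions that the birational transformations act on. -/
def ham {N : ℕ} {K : Type*} [Field K] [Algebra ℂ K] (k : Params N) (s : Fin N → ℂ) (i : Fin N)
    (q p : Fin N → K) : K :=
  let c : ℂ → K := algebraMap ℂ K
  (q i * (c k.α + ∑ j, q j * p j) * (c (k.α + k.κinf) + ∑ j, q j * p j)
    + c (s i) * p i * (q i * p i - c (k.θ i))
    - ∑ j ∈ Finset.univ.erase i, c (coefR s j i) * (q j * p j - c (k.θ j)) * q i * p j
    - ∑ j ∈ Finset.univ.erase i, c (coefS s i j) * (q i * p i - c (k.θ i)) * q j * p i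
    - ∑ j ∈ Finset.univ.erase i, c (coefR s i j) * q j * p j * (q i * p i - c (k.θ i))
    - ∑ j ∈ Finset.univ.erase i, c (coefR s i j) * q i * p i * (q j * p j - c (k.θ j))
    - c (s i + 1) * (q i * p i - c (k.θ i)) * q i * p i
    + c (k.κ1 * s i + k.κ0 - 1) * q i * p i)
  / c (s i * (s i - 1))

/-- The partial derivative `∂f/∂x_i`. -/
def pd {N : ℕ} (i : Fin N) (f : (Fin N → ℂ) → ℂ) (x : Fin N → ℂ) : ℂ :=
  fderiv ℂ f x (Pi.single i 1)

/-- `(q, p)` is a holomorphic solution of the Garnier system with parameter `k` on the open set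
`U`, which avoids the fixed singularities `s_i = 0`, `s_i = 1`, `s_i = s_j`. -/
structure IsSolution {N : ℕ} (k : Params N) (U : Set (Fin N → ℂ))
    (q p : (Fin N → ℂ) → Fin N → ℂ) : Prop where
  isOpen : IsOpen U
  ne_zero : ∀ s ∈ U, ∀ i, s i ≠ 0
  ne_one : ∀ s ∈ U, ∀ i, s i ≠ 1
  ne_of_ne : ∀ s ∈ U, ∀ i j, i ≠ j → s i ≠ s j
  differentiableOn_q : DifferentiableOn ℂ q U
  differentiableOn_p : DifferentiableOn ℂ p U
  eq_q : ∀ s ∈ U, ∀ i j,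
    pd j (fun t => q t i) s = pd i (fun y => ham k s j (q s) y) (p s)
  eq_p : ∀ s ∈ U, ∀ i j,
    pd j (fun t => p t i) s = -pd i (fun x => ham k s j x (p s)) (q s)

/-! ### Birational transformations

All of them fix `s`. Each is given as a partial bijection of the triples `(κ, q, p)`, with the
nonvanishing of its denominators as domain. -/

/-- A parameter vector together with canonical variables in `K`. -/
@[ext] structure State (N : ℕ) (K : Type*) where
  par : Params N
  q : Fin N → K
  p : Fin N → K

section Transformations

variable {N : ℕ} {K : Type*} [Field K] [Algebra ℂ K]

/-- `R_{κ_∞}`: `κ_∞ ↦ -κ_∞`, `Q_i = q_i`, `P_i = p_i`. -/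
def Rinf (N : ℕ) (K : Type*) : PartialEquiv (State N K) (State N K) where
  toFun x := { x with par := { x.par with κinf := -x.par.κinf } }
  invFun x := { x with par := { x.par with κinf := -x.par.κinf } }
  source := Set.univ
  target := Set.univ
  map_source' _ _ := Set.mem_univ _
  map_target' _ _ := Set.mem_univ _
  left_inv' x _ := by simp
  right_inv' x _ := by simp

/-- The formula of `R_{κ₁}`: `κ₁ ↦ -κ₁`, `Q_i = q_i`, `P_i = p_i - κ₁ / (g₁ - 1)`, where
`g₁ = ∑ q_j`. -/
def R1Fun (x : State N K) : State N K where
  par := { x.par with κ1 := -x.par.κ1 }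
  q := x.q
  p := fun i => x.p i - algebraMap ℂ K x.par.κ1 / (∑ j, x.q j - 1)

theorem R1Fun_R1Fun (x : State N K) : R1Fun (R1Fun x) = x := by
  ext i <;> simp [R1Fun, neg_div]

/-- `R_{κ₁}`. -/
def R1 (N : ℕ) (K : Type*) [Field K] [Algebra ℂ K] :
    PartialEquiv (State N K) (State N K) where
  toFun := R1Fun
  invFun := R1Fun
  source := {x | ∑ j, x.q j - 1 ≠ 0}
  target := {x | ∑ j, x.q j - 1 ≠ 0}
  map_source' _ hx := hx
  map_target' _ hx := hx
  left_inv' x _ := R1Fun_R1Fun x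
  right_inv' x _ := R1Fun_R1Fun x

/-- The formula of `R_{κ₀}`: `κ₀ ↦ -κ₀`, `Q_i = q_i`, `P_i = p_i - κ₀ / (s_i (g_s - 1))`, where
`g_s = ∑ q_j / s_j`. -/
def R0Fun (s : Fin N → ℂ) (x : State N K) : State N K where
  par := { x.par with κ0 := -x.par.κ0 }
  q := x.q
  p := fun i => x.p i - algebraMap ℂ K x.par.κ0 /
    (algebraMap ℂ K (s i) * (∑ j, x.q j / algebraMap ℂ K (s j) - 1))

theorem R0Fun_R0Fun (s : Fin N → ℂ) (x : State N K) : R0Fun s (R0Fun s x) = x := by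
  ext i <;> simp [R0Fun, neg_div]

/-- `R_{κ₀}`. -/
def R0 (K : Type*) [Field K] [Algebra ℂ K] (s : Fin N → ℂ) :
    PartialEquiv (State N K) (State N K) where
  toFun := R0Fun s
  invFun := R0Fun s
  source := {x | (∀ i, s i ≠ 0) ∧ ∑ j, x.q j / algebraMap ℂ K (s j) - 1 ≠ 0}
  target := {x | (∀ i, s i ≠ 0) ∧ ∑ j, x.q j / algebraMap ℂ K (s j) - 1 ≠ 0}
  map_source' _ hx := hx
  map_target' _ hx := hx
  left_inv' x _ := R0Fun_R0Fun s x
  right_inv' x _ := R0Fun_R0Fun s x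

/-- The formula of `R_{θ_j}`: `θ_j ↦ -θ_j`, `Q_i = q_i`, `P_j = p_j - θ_j / q_j` and
`P_i = p_i` for `i ≠ j`. -/
def RthetaFun (j : Fin N) (x : State N K) : State N K where
  par := { x.par with θ := Function.update x.par.θ j (-x.par.θ j) }
  q := x.q
  p := Function.update x.p j (x.p j - algebraMap ℂ K (x.par.θ j) / x.q j)

theorem RthetaFun_RthetaFun (j : Fin N) (x : State N K) :
    RthetaFun j (RthetaFun j x) = x := by
  ext i <;> simp [RthetaFun, neg_div]

/-- `R_{θ_j}`. -/
def Rtheta (K : Type*) [Field K] [Algebra ℂ K] (j : Fin N) :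
    PartialEquiv (State N K) (State N K) where
  toFun := RthetaFun j
  invFun := RthetaFun j
  source := {x | x.q j ≠ 0}
  target := {x | x.q j ≠ 0}
  map_source' _ hx := hx
  map_target' _ hx := hx
  left_inv' x _ := RthetaFun_RthetaFun j x
  right_inv' x _ := RthetaFun_RthetaFun j x

/-- `(α + ∑ q_j p_j)(α + κ_∞ + ∑ q_j p_j)`. -/
def tauDen (x : State N K) : K :=
  (algebraMap ℂ K x.par.α + ∑ j, x.q j * x.p j) *
    (algebraMap ℂ K (x.par.α + x.par.κinf) + ∑ j, x.q j * x.p j)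

/-- The formula of `R_τ`: `κ ↦ (1 - κ₀, 1 - κ₁, -κ_∞, -θ₁, …, -θ_N)`,
`Q_i = s_i p_i (q_i p_i - θ_i) / ((α + ∑ q_j p_j)(α + κ_∞ + ∑ q_j p_j))`, and `P_i` is the
rational function with `Q_i P_i = -q_i p_i`. -/
def RtauFun (s : Fin N → ℂ) (x : State N K) : State N K where
  par :=
    { κ0 := -x.par.κ0 + 1
      κ1 := -x.par.κ1 + 1
      κinf := -x.par.κinf
      θ := fun i => -x.par.θ i }
  q := fun i => algebraMap ℂ K (s i) * x.p i *
    (x.q i * x.p i - algebraMap ℂ K (x.par.θ i)) / tauDen x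
  p := fun i => -(x.q i * tauDen x) /
    (algebraMap ℂ K (s i) * (x.q i * x.p i - algebraMap ℂ K (x.par.θ i)))

/-- The domain of `R_τ`: all denominators are nonzero. -/
def RtauDom (s : Fin N → ℂ) : Set (State N K) :=
  {x | (∀ i, s i ≠ 0) ∧ tauDen x ≠ 0 ∧
    ∀ i, x.q i * x.p i - algebraMap ℂ K (x.par.θ i) ≠ 0}

theorem RtauFun_mul (s : Fin N → ℂ) {x : State N K} (hx : x ∈ RtauDom s) (i : Fin N) :
    (RtauFun s x).q i * (RtauFun s x).p i = -(x.q i * x.p i) := by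
  obtain ⟨hs, hD, hθ⟩ := hx
  have h1 : algebraMap ℂ K (s i) ≠ 0 := by simpa using hs i
  have h2 := hθ i
  simp only [RtauFun]
  generalize x.q i * x.p i - algebraMap ℂ K (x.par.θ i) = w at h2 ⊢
  field_simp

theorem tauDen_RtauFun (s : Fin N → ℂ) {x : State N K} (hx : x ∈ RtauDom s) :
    tauDen (RtauFun s x) = tauDen x := by
  have hα : (RtauFun s x).par.α = -x.par.α := by
    simp only [Params.α, RtauFun, Finset.sum_neg_distrib]
    ring
  have hκ : (RtauFun s x).par.κinf = -x.par.κinf := rfl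
  simp only [tauDen, RtauFun_mul s hx, hα, hκ, Finset.sum_neg_distrib, map_add, map_neg]
  ring

theorem RtauFun_mem (s : Fin N → ℂ) {x : State N K} (hx : x ∈ RtauDom s) :
    RtauFun s x ∈ RtauDom (K := K) s := by
  refine ⟨hx.1, by rw [tauDen_RtauFun s hx]; exact hx.2.1, fun i => ?_⟩
  have h : (RtauFun s x).par.θ i = -x.par.θ i := rfl
  rw [RtauFun_mul s hx, h, map_neg, ← neg_sub']
  exact neg_ne_zero.mpr (hx.2.2 i)

theorem RtauFun_RtauFun (s : Fin N → ℂ) {x : State N K} (hx : x ∈ RtauDom s) :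
    RtauFun s (RtauFun s x) = x := by
  have hm := RtauFun_mul s hx
  have hd := tauDen_RtauFun s hx
  obtain ⟨hs, hD, hθ⟩ := hx
  have hne : ∀ i, algebraMap ℂ K (s i) ≠ 0 := fun i => by simpa using hs i
  have key : ∀ i, (RtauFun s x).q i * (RtauFun s x).p i
      - algebraMap ℂ K ((RtauFun s x).par.θ i)
      = -(x.q i * x.p i - algebraMap ℂ K (x.par.θ i)) := by
    intro i
    have h : (RtauFun s x).par.θ i = -x.par.θ i := rfl
    rw [hm, h, map_neg]
    ring
  ext i
  · simp [RtauFun]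
  · simp [RtauFun]
  · simp [RtauFun]
  · simp [RtauFun]
  · change algebraMap ℂ K (s i) * (RtauFun s x).p i * ((RtauFun s x).q i * (RtauFun s x).p i
      - algebraMap ℂ K ((RtauFun s x).par.θ i)) / tauDen (RtauFun s x) = x.q i
    rw [key, hd]
    have h1 := hne i
    have h2 := hθ i
    simp only [RtauFun]
    generalize x.q i * x.p i - algebraMap ℂ K (x.par.θ i) = w at h2 ⊢
    field_simp
  · change -((RtauFun s x).q i * tauDen (RtauFun s x)) / (algebraMap ℂ K (s i) *
      ((RtauFun s x).q i * (RtauFun s x).p i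
        - algebraMap ℂ K ((RtauFun s x).par.θ i))) = x.p i
    rw [key, hd]
    have h1 := hne i
    have h2 := hθ i
    simp only [RtauFun]
    generalize x.q i * x.p i - algebraMap ℂ K (x.par.θ i) = w at h2 ⊢
    field_simp

/-- `R_τ`. -/
def Rtau (K : Type*) [Field K] [Algebra ℂ K] (s : Fin N → ℂ) :
    PartialEquiv (State N K) (State N K) where
  toFun := RtauFun s
  invFun := RtauFun s
  source := RtauDom s
  target := RtauDom s
  map_source' _ hx := RtauFun_mem s hx
  map_target' _ hx := RtauFun_mem s hx
  left_inv' _ hx := RtauFun_RtauFun s hx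
  right_inv' _ hx := RtauFun_RtauFun s hx

/-- `R_{θ₁} ∘ ⋯ ∘ R_{θ_N}`. -/
def RthetaAll (N : ℕ) (K : Type*) [Field K] [Algebra ℂ K] :
    PartialEquiv (State N K) (State N K) :=
  (List.finRange N).foldr (fun j e => e.trans (Rtheta K j)) (PartialEquiv.refl _)

/-- `l = R_{κ₁} ∘ R_τ ∘ R_{θ₁} ∘ ⋯ ∘ R_{θ_N} ∘ R_{κ_∞} ∘ R_{κ₀}` (`e.trans f` is `f ∘ e`). -/
def shift (K : Type*) [Field K] [Algebra ℂ K] (s : Fin N → ℂ) :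
    PartialEquiv (State N K) (State N K) :=
  ((((R0 K s).trans (Rinf N K)).trans (RthetaAll N K)).trans (Rtau K s)).trans (R1 N K)

end Transformations

/-! ### Rational functions on the phase space -/

/-- Polynomials in the canonical variables: `q_i` is `X (Sum.inl i)`, `p_i` is `X (Sum.inr i)`. -/
abbrev PhasePoly (N : ℕ) : Type := MvPolynomial (Fin N ⊕ Fin N) ℂ

/-- The field `ℂ(q, p)`. -/
abbrev PhaseField (N : ℕ) : Type := FractionRing (PhasePoly N)

/-- The generic point: the parameter `k` and the indeterminates `q_i`, `p_i`. -/
def genericState {N : ℕ} (k : Params N) : State N (PhaseField N) where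
  par := k
  q := fun i => algebraMap (PhasePoly N) (PhaseField N) (MvPolynomial.X (Sum.inl i))
  p := fun i => algebraMap (PhasePoly N) (PhaseField N) (MvPolynomial.X (Sum.inr i))

/-- `l(H_i)`, for fixed `s` a rational function of `q, p`: the Hamiltonian
`H_i(l(q), l(p), s; l(κ))`. -/
def hamPlus {N : ℕ} (k : Params N) (s : Fin N → ℂ) (i : Fin N) : PhaseField N :=
  let y := shift (PhaseField N) s (genericState k)
  ham y.par s i y.q y.p

/-- `l⁻¹(H_i)`, for fixed `s` a rational function of `q, p`. -/
def hamMinus {N : ℕ} (k : Params N) (s : Fin N → ℂ) (i : Fin N) : PhaseField N :=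
  let y := (shift (PhaseField N) s).symm (genericState k)
  ham y.par s i y.q y.p

/-- The rational function `r` is regular at the point `(q, p)` and has the value `v` there:
`r = a / b` with polynomials `a`, `b` such that `b(q, p) ≠ 0` and `v = a(q, p) / b(q, p)`. -/
def HasValueAt {N : ℕ} (r : PhaseField N) (q p : Fin N → ℂ) (v : ℂ) : Prop :=
  ∃ a b : PhasePoly N, MvPolynomial.eval (Sum.elim q p) b ≠ 0 ∧
    r = algebraMap (PhasePoly N) (PhaseField N) a / algebraMap (PhasePoly N) (PhaseField N) b ∧
    v = MvPolynomial.eval (Sum.elim q p) a / MvPolynomial.eval (Sum.elim q p) b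

/-- `H_i(s)` along `(q(s), p(s))`. -/
def hamAlong {N : ℕ} (k : Params N) (q p : (Fin N → ℂ) → Fin N → ℂ) (i : Fin N)
    (s : Fin N → ℂ) : ℂ :=
  ham k s i (q s) (p s)

/-- `F(s) = (∑_j (s_j - 1) ∂_{s_j} - 1) ∑_k s_k (s_k - 1) H_k - κ₁(κ₀ - 1) + α(α + κ_∞)`. -/
def todaF {N : ℕ} (k : Params N) (q p : (Fin N → ℂ) → Fin N → ℂ) (s : Fin N → ℂ) : ℂ :=
  let h : (Fin N → ℂ) → ℂ := fun t => ∑ m, t m * (t m - 1) * hamAlong k q p m t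
  (∑ j, (s j - 1) * pd j h s - h s) - k.κ1 * (k.κ0 - 1) + k.α * (k.α + k.κinf)

end

end Garnier

/-! The second difference of `H_i` and the logarithmic derivative of `F` are both computed as
explicit rational functions of `(q, p)`, and these agree.

Algebraic side. Each elementary transformation preserves `H_i` up to a function of `s` alone, except
for two extra terms: one from `R_{κ₀}`, one from `R_τ`, the transformations whose formulas involve
`s`. Along `l` all of this adds up to `l(H_i) = H_i - q_i p_i / s_i` (`ham_shift`). The same
identity at the preimage gives `l⁻¹(H_i) = H_i + l⁻¹(q_i p_i) / s_i`, so the second difference is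
`(l⁻¹(q_i p_i) - q_i p_i) / s_i`. Writing out `l⁻¹(q_i p_i)` turns this into `todaPolyDeriv /
todaPoly` (`ham_shift_sub_add`).

Analytic side. Summation with the weights `ρ = 1` and `ρ = 1/s` gives closed forms for `∑ s_k (s_k -
1) H_k` and `∑ (s_k - 1) H_k`. Differentiating the first sum along `∑ (s_j - 1) ∂/∂s_j` yields its
explicit `s`-derivative plus its Poisson bracket with the second sum; the bracket terms cancel.
Hence `F = -A (D - V) - κ₁ (κ₀ - 1)` with `A = ∑ q_j - 1`, `D = (α + ∑ q_j p_j)(α + κ_∞ + ∑ q_j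
p_j)`, `V = ∑ p_j (q_j p_j - θ_j)` (`IsSolution.todaF_eq`). This contains no explicit `s`, so
`∂F/∂s_i` is its bracket with `H_i` (`IsSolution.pd_todaF`).

A solution may meet poles of the intermediate maps even where `l(H_i)` and `l⁻¹(H_i)` are regular.
The algebraic identity is therefore proved at the generic point, in `ℂ(q, p)`, and evaluated
afterwards; values are well defined by `HasValueAt.unique`. -/

namespace Garnier

noncomputable section

/-- `s` avoids the fixed singularities `s_i = 0`, `s_i = 1`, `s_i = s_j`. -/
structure Admissible {N : ℕ} (s : Fin N → ℂ) : Prop where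
  ne_zero : ∀ i, s i ≠ 0
  ne_one : ∀ i, s i ≠ 1
  ne_of_ne : ∀ i j, i ≠ j → s i ≠ s j

/-! ### Identities between the coefficients `R_{ij}` and `S_{ij}`. -/

section Coefficients

variable {N : ℕ} {s : Fin N → ℂ}

-- The denominator is zero and division by zero gives `0`, so the sums over `j ≠ i` in `H_i` may run
-- over all `j`.
@[simp] theorem coefR_self (s : Fin N → ℂ) (i : Fin N) : coefR s i i = 0 := by simp [coefR]

@[simp] theorem coefS_self (s : Fin N → ℂ) (i : Fin N) : coefS s i i = 0 := by simp [coefS]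

theorem coefR_add_coefR (hs : Admissible s) {i j : Fin N} (h : i ≠ j) :
    coefR s i j + coefR s j i = 1 := by
  have h1 := sub_ne_zero.mpr (hs.ne_of_ne i j h)
  have h2 := sub_ne_zero.mpr (hs.ne_of_ne j i h.symm)
  simp only [coefR]
  field_simp
  ring

theorem coefR_add_coefS (hs : Admissible s) {i j : Fin N} (h : i ≠ j) :
    coefR s i j + coefS s i j = s i := by
  have h1 := sub_ne_zero.mpr (hs.ne_of_ne i j h)
  have h2 := sub_ne_zero.mpr (hs.ne_of_ne j i h.symm)
  simp only [coefR, coefS]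
  field_simp
  ring

theorem coefS_mul (s : Fin N → ℂ) (i j : Fin N) :
    coefS s i j * s j = s i * coefR s j i := by
  simp only [coefR, coefS]
  ring

theorem coefR_mul_add_coefR_mul (hs : Admissible s) {i j : Fin N} (h : i ≠ j) :
    coefR s i j * s j + coefR s j i * s i = s i * s j := by
  have h1 := sub_ne_zero.mpr (hs.ne_of_ne i j h)
  have h2 := sub_ne_zero.mpr (hs.ne_of_ne j i h.symm)
  simp only [coefR]
  field_simp
  ring

theorem coefR_mul_add_coefS_mul (hs : Admissible s) {i j : Fin N} (h : i ≠ j) :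
    coefR s i j * s i + coefS s i j * s j = s i := by
  have h1 := sub_ne_zero.mpr (hs.ne_of_ne i j h)
  have h2 := sub_ne_zero.mpr (hs.ne_of_ne j i h.symm)
  simp only [coefR, coefS]
  field_simp
  ring

theorem Params.two_mul_α_add (k : Params N) :
    2 * k.α + k.κinf = 1 - k.κ0 - k.κ1 - ∑ i, k.θ i := by
  simp only [Params.α]
  ring

end Coefficients

/-! ### Effect of the elementary transformations on the Hamiltonians. -/

section Algebraic

variable {N : ℕ} {K : Type*} [Field K] [Algebra ℂ K]

local notation "ι" => algebraMap ℂ K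

theorem Admissible.algebraMap_ne_zero {s : Fin N → ℂ} (hs : Admissible s) (i : Fin N) :
    ι (s i) ≠ 0 := by
  simpa using hs.ne_zero i

theorem Admissible.algebraMap_sub_one_ne_zero {s : Fin N → ℂ} (hs : Admissible s) (i : Fin N) :
    ι (s i) - 1 ≠ 0 := by
  rw [← map_one ι, ← map_sub]
  exact (map_ne_zero ι).mpr (sub_ne_zero.mpr (hs.ne_one i))

/-- The numerator `s_i (s_i - 1) H_i` in terms of `D = (α + ∑ q_j p_j)(α + κ_∞ + ∑ q_j p_j)`,
`u_j = p_j (q_j p_j - θ_j)`, `e_j = q_j p_j`, `w_j = q_j p_j - θ_j` and the coefficient `d` of the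
last term. -/
def hamNum (s : Fin N → ℂ) (i : Fin N) (D d : K) (q u e w : Fin N → K) : K :=
  q i * D + ι (s i) * u i
    - ∑ j, (ι (coefR s j i) * (q i * u j) + ι (coefS s i j) * (q j * u i)
      + ι (coefR s i j) * (e j * w i + e i * w j))
    - (ι (s i) + 1) * (w i * e i) + d * e i

/-- `(α + ∑ q_j p_j)(α + κ_∞ + ∑ q_j p_j)`. -/
def quad (k : Params N) (q p : Fin N → K) : K :=
  (ι k.α + ∑ j, q j * p j) * (ι (k.α + k.κinf) + ∑ j, q j * p j)

theorem ham_eq (k : Params N) (s : Fin N → ℂ) (i : Fin N) (q p : Fin N → K) :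
    ham k s i q p = hamNum s i (quad k q p) (ι (k.κ1 * s i + k.κ0 - 1)) q
      (fun j => p j * (q j * p j - ι (k.θ j))) (fun j => q j * p j)
      (fun j => q j * p j - ι (k.θ j)) / ι (s i * (s i - 1)) := by
  simp only [ham, hamNum, quad]
  congr 1
  rw [Finset.sum_erase _ (by simp), Finset.sum_erase _ (by simp), Finset.sum_erase _ (by simp),
    Finset.sum_erase _ (by simp)]
  simp only [Finset.sum_add_distrib, mul_add, map_add, map_one]
  simp only [mul_assoc, mul_comm, mul_left_comm]
  ring

/-- The effect on the numerator of a translation `p_j ↦ p_j - b ρ_j`. -/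
theorem hamNum_translate {s : Fin N → ℂ} (i : Fin N)
    (D L b d d' : K) (ρ q u e w : Fin N → K)
    (h1 : ∀ j, i ≠ j → ι (coefR s j i) * ρ j + ι (coefR s i j) * ρ i = 1)
    (h2 : ∀ j, i ≠ j → ι (coefS s i j) * ρ i + ι (coefR s i j) * ρ j = ι (s i) * ρ i * ρ j)
    (h3 : (1 - ρ i) * (1 - ι (s i) * ρ i) = 0) :
    hamNum s i (D - b * L + b ^ 2) d' q
      (fun j => u j - b * ρ j * (e j + w j) + b ^ 2 * ρ j ^ 2 * q j)
      (fun j => e j - b * ρ j * q j) (fun j => w j - b * ρ j * q j) =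
    hamNum s i D d q u e w - b * q i * (L - ∑ j, (e j + w j))
      - b * (1 - ∑ j, ρ j * q j) *
        (ι (s i) * ρ i * (e i + w i) - b * q i * (1 + ι (s i) * ρ i ^ 2))
      + d' * (e i - b * ρ i * q i) - d * e i := by
  -- The identities `h1`, `h2` hold only for `j ≠ i`, whereas the summand on the left vanishes at `j
  -- = i`. The `if` term removes what the general formula would contribute there.
  have key : ∀ j, ι (coefR s j i) * (q i * (u j - b * ρ j * (e j + w j) + b ^ 2 * ρ j ^ 2 * q j))
      + ι (coefS s i j) * (q j * (u i - b * ρ i * (e i + w i) + b ^ 2 * ρ i ^ 2 * q i))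
      + ι (coefR s i j) * ((e j - b * ρ j * q j) * (w i - b * ρ i * q i)
        + (e i - b * ρ i * q i) * (w j - b * ρ j * q j))
      = ι (coefR s j i) * (q i * u j) + ι (coefS s i j) * (q j * u i)
      + ι (coefR s i j) * (e j * w i + e i * w j)
      + (-b * q i * (e j + w j) - b * ι (s i) * ρ i * (e i + w i) * (ρ j * q j)
        + b ^ 2 * q i * (1 + ι (s i) * ρ i ^ 2) * (ρ j * q j))
      + (if j = i then b * q i * (e i + w i) + b * ι (s i) * ρ i * (e i + w i) * (ρ i * q i)
        - b ^ 2 * q i * (1 + ι (s i) * ρ i ^ 2) * (ρ i * q i) else 0) := by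
    intro j
    by_cases hj : j = i
    · subst hj
      simp only [coefR_self, coefS_self, map_zero, if_true]
      ring
    · have e1 := h1 j (Ne.symm hj)
      have e2 := h2 j (Ne.symm hj)
      simp only [hj, if_false]
      linear_combination (-b * q i * (e j + w j) + b ^ 2 * q i * q j * ρ j) * e1 +
        (-b * q j * (e i + w i) + b ^ 2 * q i * q j * ρ i) * e2
  simp only [hamNum]
  rw [Finset.sum_congr rfl fun j _ => key j]
  simp only [Finset.sum_add_distrib, Finset.sum_sub_distrib, ← Finset.mul_sum,
    Finset.sum_ite_eq', Finset.mem_univ, if_true]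
  linear_combination (-b * (e i + w i) * q i + b ^ 2 * ρ i * q i ^ 2) * h3

/-- Common core of `R_{κ₁}` (`ρ = 1`) and `R_{κ₀}` (`ρ = 1/s`). By `hb` the sum `E = ∑ q_j p_j`
becomes `E - b - κ`, and `α` becomes `α + κ`, so both factors of `D` drop by exactly `b`. The terms
of the numerator quadratic in `p` then enter only through `2α + κ_∞ + ∑ θ_j = 1 - κ₀ - κ₁`, a
constant. -/
theorem ham_translate {s : Fin N → ℂ} (i : Fin N) (k k' : Params N) (κ : ℂ)
    (b : K) (ρ q p : Fin N → K) (hθ : k'.θ = k.θ) (hinf : k'.κinf = k.κinf)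
    (hα : k'.α = k.α + κ) (hb : b * (∑ j, ρ j * q j - 1) = ι κ)
    (h1 : ∀ j, i ≠ j → ι (coefR s j i) * ρ j + ι (coefR s i j) * ρ i = 1)
    (h2 : ∀ j, i ≠ j → ι (coefS s i j) * ρ i + ι (coefR s i j) * ρ j = ι (s i) * ρ i * ρ j)
    (h3 : (1 - ρ i) * (1 - ι (s i) * ρ i) = 0) :
    ham k' s i q (fun j => p j - b * ρ j) = ham k s i q p +
      (-b * q i * ι (1 - k.κ0 - k.κ1)
        + ι κ * (ι (s i) * ρ i * (2 * (q i * p i) - ι (k.θ i)) - b * q i * (1 + ι (s i) * ρ i ^ 2))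
        + ι (k'.κ1 * s i + k'.κ0 - 1) * (q i * p i - b * ρ i * q i)
        - ι (k.κ1 * s i + k.κ0 - 1) * (q i * p i)) / ι (s i * (s i - 1)) := by
  have hE : ∑ j, q j * (p j - b * ρ j) = ∑ j, q j * p j - b - ι κ := by
    have h : ∀ j, q j * (p j - b * ρ j) = q j * p j - b * (ρ j * q j) := fun j => by ring
    simp only [h, Finset.sum_sub_distrib, ← Finset.mul_sum]
    linear_combination -hb
  have hD : quad k' q (fun j => p j - b * ρ j) =
      quad k q p - b * (ι (2 * k.α + k.κinf) + 2 * ∑ j, q j * p j) + b ^ 2 := by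
    simp only [quad, hE, hα, hinf, map_add, map_mul, map_ofNat]
    ring
  have hZ : ∑ j, (q j * p j + (q j * p j - ι (k.θ j))) =
      2 * ∑ j, q j * p j - ∑ j, ι (k.θ j) := by
    simp only [Finset.sum_add_distrib, Finset.sum_sub_distrib]
    ring
  rw [ham_eq, ham_eq, ← add_div]
  congr 1
  have ht := hamNum_translate i (quad k q p) (ι (2 * k.α + k.κinf) + 2 * ∑ j, q j * p j) b
    (ι (k.κ1 * s i + k.κ0 - 1)) (ι (k'.κ1 * s i + k'.κ0 - 1)) ρ q
    (fun j => p j * (q j * p j - ι (k.θ j))) (fun j => q j * p j)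
    (fun j => q j * p j - ι (k.θ j)) h1 h2 h3
  have hu : (fun j => (p j - b * ρ j) * (q j * (p j - b * ρ j) - ι (k'.θ j))) =
      fun j => p j * (q j * p j - ι (k.θ j)) - b * ρ j * (q j * p j + (q j * p j - ι (k.θ j)))
        + b ^ 2 * ρ j ^ 2 * q j := by
    funext j; rw [hθ]; ring
  have he : (fun j => q j * (p j - b * ρ j)) = fun j => q j * p j - b * ρ j * q j := by
    funext j; ring
  have hw : (fun j => q j * (p j - b * ρ j) - ι (k'.θ j)) =
      fun j => q j * p j - ι (k.θ j) - b * ρ j * q j := by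
    funext j; rw [hθ]; ring
  rw [hD, hu, he, hw, ht, hZ, k.two_mul_α_add]
  simp only [map_sub, map_sum]
  linear_combination (ι (s i) * ρ i * (2 * (q i * p i) - ι (k.θ i))
    - b * q i * (1 + ι (s i) * ρ i ^ 2)) * hb

theorem ham_R1Fun {s : Fin N → ℂ} (hs : Admissible s) (i : Fin N) (x : State N K)
    (hx : ∑ j, x.q j - 1 ≠ 0) :
    ham (R1Fun x).par s i (R1Fun x).q (R1Fun x).p =
      ham x.par s i x.q x.p - ι (x.par.κ1 * s i * x.par.θ i / (s i * (s i - 1))) := by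
  have h := ham_translate i x.par (R1Fun x).par x.par.κ1
    (ι x.par.κ1 / (∑ j, x.q j - 1)) (fun _ => 1) x.q x.p rfl rfl
    (by simp only [Params.α, R1Fun]; ring) (by simp only [one_mul]; field_simp)
    (fun j hj => by
      rw [mul_one, mul_one, ← map_add, coefR_add_coefR hs hj.symm, map_one])
    (fun j hj => by
      rw [mul_one, mul_one, mul_one, mul_one, ← map_add, add_comm, coefR_add_coefS hs hj])
    (by ring)
  simp only [mul_one] at h
  simp only [R1Fun] at h ⊢
  rw [h, sub_eq_add_neg, map_div₀, ← neg_div]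
  simp only [map_sub, map_mul, map_add, map_neg, map_one]
  ring

/-- The last term is the explicit `s_i`-derivative of `κ₀ log (∑ q_j / s_j - 1)`, the function whose
`q`-gradient is subtracted from `p`. -/
theorem ham_R0Fun {s : Fin N → ℂ} (hs : Admissible s) (i : Fin N) (x : State N K)
    (hx : ∑ j, x.q j / ι (s j) - 1 ≠ 0) :
    ham (R0Fun s x).par s i (R0Fun s x).q (R0Fun s x).p =
      ham x.par s i x.q x.p - ι (x.par.κ0 * x.par.θ i / (s i * (s i - 1)))
      - ι x.par.κ0 * x.q i / (ι (s i) ^ 2 * (∑ j, x.q j / ι (s j) - 1)) := by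
  have hs0 := hs.algebraMap_ne_zero (K := K)
  have hs1 := hs.algebraMap_sub_one_ne_zero (K := K) i
  have h := ham_translate i x.par (R0Fun s x).par x.par.κ0
    (ι x.par.κ0 / (∑ j, x.q j / ι (s j) - 1)) (fun j => 1 / ι (s j)) x.q x.p rfl rfl
    (by simp only [Params.α, R0Fun]; ring)
    (by simp only [one_div_mul_eq_div]; field_simp)
    (fun j hj => by
      have e := congrArg ι (coefR_mul_add_coefR_mul hs hj)
      simp only [map_mul, map_add] at e
      have := hs0 i
      have := hs0 j
      field_simp
      linear_combination e)
    (fun j hj => by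
      have e := congrArg ι (coefR_mul_add_coefS_mul hs hj)
      simp only [map_mul, map_add] at e
      have := hs0 i
      have := hs0 j
      field_simp
      linear_combination e)
    (by have := hs0 i; field_simp; ring)
  have hp : ∀ j, x.p j - ι x.par.κ0 / (∑ j, x.q j / ι (s j) - 1) * (1 / ι (s j)) =
      x.p j - ι x.par.κ0 / (ι (s j) * (∑ j, x.q j / ι (s j) - 1)) := fun j => by
    rw [div_mul_div_comm, mul_one, mul_comm (_ - 1)]
  simp only [hp] at h
  simp only [R0Fun] at h ⊢
  rw [h]
  generalize ∑ j, x.q j / ι (s j) - 1 = B at hx ⊢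
  have := hs0 i
  simp only [map_sub, map_mul, map_add, map_neg, map_one, map_div₀]
  field_simp
  ring

/-- The two factors of `D` are exchanged, because `α` becomes `α + κ_∞`. -/
theorem ham_Rinf (s : Fin N → ℂ) (i : Fin N) (x : State N K) :
    ham (Rinf N K x).par s i (Rinf N K x).q (Rinf N K x).p = ham x.par s i x.q x.p := by
  have hD : quad (Rinf N K x).par (Rinf N K x).q (Rinf N K x).p = quad x.par x.q x.p := by
    have h : (Rinf N K x).par.α = x.par.α + x.par.κinf := by
      simp only [Params.α, Rinf, PartialEquiv.coe_mk]; ring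
    simp only [quad, h]
    simp only [Rinf, map_add, map_neg]
    ring
  rw [ham_eq, ham_eq, hD]
  rfl

/-- The formula of `R_{θ₁} ∘ ⋯ ∘ R_{θ_N}`. -/
def RthetaAllFun (x : State N K) : State N K where
  par := { x.par with θ := fun j => -x.par.θ j }
  q := x.q
  p := fun j => x.p j - ι (x.par.θ j) / x.q j

theorem RthetaAllFun_RthetaAllFun (x : State N K) : RthetaAllFun (RthetaAllFun x) = x := by
  ext i <;> simp [RthetaAllFun, neg_div]

/-- The transformation exchanges `q_j p_j` and `q_j p_j - θ_j` and fixes `p_j (q_j p_j - θ_j)` and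
`D`. Only the last, linear term of the numerator is not symmetric under this. -/
theorem ham_RthetaAllFun {s : Fin N → ℂ} (i : Fin N) (x : State N K) (hx : ∀ j, x.q j ≠ 0) :
    ham (RthetaAllFun x).par s i (RthetaAllFun x).q (RthetaAllFun x).p =
      ham x.par s i x.q x.p
        - ι ((x.par.κ1 * s i + x.par.κ0 - 1) * x.par.θ i / (s i * (s i - 1))) := by
  have he : ∀ j, x.q j * (x.p j - ι (x.par.θ j) / x.q j) = x.q j * x.p j - ι (x.par.θ j) :=
    fun j => by have := hx j; field_simp
  have hD : quad (RthetaAllFun x).par (RthetaAllFun x).q (RthetaAllFun x).p =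
      quad x.par x.q x.p := by
    have h : (RthetaAllFun x).par.α = x.par.α + ∑ j, x.par.θ j := by
      simp only [Params.α, RthetaAllFun, Finset.sum_neg_distrib]; ring
    simp only [quad, h]
    simp only [RthetaAllFun, he, Finset.sum_sub_distrib, map_add, map_sum]
    ring
  rw [ham_eq, ham_eq, hD, map_div₀, ← sub_div]
  congr 1
  have hu : ∀ j, (x.p j - ι (x.par.θ j) / x.q j) * (x.q j * x.p j) =
      x.p j * (x.q j * x.p j - ι (x.par.θ j)) := fun j => by
    have := hx j; field_simp
  simp only [hamNum, RthetaAllFun, he, map_neg, sub_neg_eq_add, sub_add_cancel, hu, map_mul]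
  have hsum : ∀ j, (x.q j * x.p j - ι (x.par.θ j)) * (x.q i * x.p i) +
      (x.q i * x.p i - ι (x.par.θ i)) * (x.q j * x.p j) =
      x.q j * x.p j * (x.q i * x.p i - ι (x.par.θ i)) +
      x.q i * x.p i * (x.q j * x.p j - ι (x.par.θ j)) := fun j => by ring
  simp only [hsum]
  ring

/-- With `u_j = p_j (q_j p_j - θ_j)`, the map exchanges `q_j D` and `s_j u_j` and changes the sign
of `q_j p_j` and `q_j p_j - θ_j`. By `coefS_mul` the `R_{ji}` and `S_{ij}` terms trade places, so
again only the linear term changes. -/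
theorem ham_RtauFun {s : Fin N → ℂ} (hs : Admissible s) (i : Fin N) (x : State N K)
    (hx : x ∈ RtauDom s) :
    ham (RtauFun s x).par s i (RtauFun s x).q (RtauFun s x).p =
      ham x.par s i x.q x.p - x.q i * x.p i / ι (s i) := by
  have hs0 := hs.algebraMap_ne_zero (K := K)
  have hs1 := hs.algebraMap_sub_one_ne_zero (K := K) i
  have hm := RtauFun_mul s hx
  have hD : quad (RtauFun s x).par (RtauFun s x).q (RtauFun s x).p = quad x.par x.q x.p :=
    tauDen_RtauFun s hx
  have hd : quad x.par x.q x.p ≠ 0 := hx.2.1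
  have hw : ∀ j, -(x.q j * x.p j) - ι ((RtauFun s x).par.θ j) =
      -(x.q j * x.p j - ι (x.par.θ j)) := fun j => by
    have h : (RtauFun s x).par.θ j = -x.par.θ j := rfl
    rw [h, map_neg]; ring
  have hu : ∀ j, (RtauFun s x).p j * -(x.q j * x.p j - ι (x.par.θ j)) =
      x.q j * quad x.par x.q x.p / ι (s j) := fun j => by
    have h1 := hx.2.2 j
    have h2 := hs0 j
    change -(x.q j * quad x.par x.q x.p) / (ι (s j) * (x.q j * x.p j - ι (x.par.θ j))) * _ = _
    generalize x.q j * x.p j - ι (x.par.θ j) = w at h1 ⊢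
    field_simp
  have hq : ∀ j, (RtauFun s x).q j = ι (s j) * (x.p j * (x.q j * x.p j - ι (x.par.θ j))) /
      quad x.par x.q x.p := fun j => by rw [← mul_assoc]; rfl
  rw [ham_eq, ham_eq, hD]
  simp only [hm, hw, hu]
  simp only [hq, hamNum]
  have hsum : ∀ j, ι (coefR s j i) * (ι (s i) * (x.p i * (x.q i * x.p i - ι (x.par.θ i))) /
        quad x.par x.q x.p * (x.q j * quad x.par x.q x.p / ι (s j)))
      + ι (coefS s i j) * (ι (s j) * (x.p j * (x.q j * x.p j - ι (x.par.θ j))) /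
        quad x.par x.q x.p * (x.q i * quad x.par x.q x.p / ι (s i)))
      + ι (coefR s i j) * (-(x.q j * x.p j) * -(x.q i * x.p i - ι (x.par.θ i))
        + -(x.q i * x.p i) * -(x.q j * x.p j - ι (x.par.θ j)))
      = ι (coefR s j i) * (x.q i * (x.p j * (x.q j * x.p j - ι (x.par.θ j))))
      + ι (coefS s i j) * (x.q j * (x.p i * (x.q i * x.p i - ι (x.par.θ i))))
      + ι (coefR s i j) * (x.q j * x.p j * (x.q i * x.p i - ι (x.par.θ i))
        + x.q i * x.p i * (x.q j * x.p j - ι (x.par.θ j))) := fun j => by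
    have e := congrArg ι (coefS_mul s i j)
    simp only [map_mul] at e
    have := hs0 i
    have := hs0 j
    generalize quad x.par x.q x.p = D at hd ⊢
    generalize x.q i * x.p i - ι (x.par.θ i) = wi
    generalize x.q j * x.p j - ι (x.par.θ j) = wj
    field_simp
    linear_combination (x.q i * x.p j * wj * ι (s j) - x.q j * x.p i * wi * ι (s i)) * e
  rw [Finset.sum_congr rfl fun j _ => hsum j]
  generalize ∑ j, (ι (coefR s j i) * (x.q i * (x.p j * (x.q j * x.p j - ι (x.par.θ j))))
      + ι (coefS s i j) * (x.q j * (x.p i * (x.q i * x.p i - ι (x.par.θ i))))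
      + ι (coefR s i j) * (x.q j * x.p j * (x.q i * x.p i - ι (x.par.θ i))
        + x.q i * x.p i * (x.q j * x.p j - ι (x.par.θ j)))) = Ξ
  generalize quad x.par x.q x.p = D at hd ⊢
  have := hs0 i
  simp only [RtauFun, map_sub, map_mul, map_add, map_neg, map_one]
  field_simp
  ring

end Algebraic

/-! ### The shift `l`, its inverse, and the second difference in closed form. -/

section Shift

variable {N : ℕ} {K : Type*} [Field K] [Algebra ℂ K]

local notation "ι" => algebraMap ℂ K

/-- Without repetitions in the list, each `R_{θ_j}` acts on its own `θ_j` and `p_j`, so the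
composite is their simultaneous application. -/
theorem foldr_Rtheta (L : List (Fin N)) (hL : L.Nodup) :
    (∀ x : State N K,
      L.foldr (fun j e => e.trans (Rtheta K j)) (PartialEquiv.refl _) x =
      { par := { x.par with θ := fun j => if j ∈ L then -x.par.θ j else x.par.θ j }
        q := x.q
        p := fun j => if j ∈ L then x.p j - ι (x.par.θ j) / x.q j else x.p j }) ∧
    (L.foldr (fun j e => e.trans (Rtheta K j)) (PartialEquiv.refl _)).source =
      {x : State N K | ∀ j ∈ L, x.q j ≠ 0} := by
  induction L with
  | nil => simp
  | cons a L ih =>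
    obtain ⟨ha, hL⟩ := List.nodup_cons.mp hL
    obtain ⟨ih1, ih2⟩ := ih hL
    refine ⟨fun x => ?_, ?_⟩
    · rw [List.foldr_cons, PartialEquiv.trans_apply, ih1 x]
      ext j
      · rfl
      · rfl
      · rfl
      · by_cases h : j = a
        · subst h
          simp [Rtheta, RthetaFun, ha]
        · simp [Rtheta, RthetaFun, h]
      · rfl
      · by_cases h : j = a
        · subst h
          simp [Rtheta, RthetaFun, ha]
        · simp [Rtheta, RthetaFun, h]
    · ext x
      rw [List.foldr_cons, PartialEquiv.trans_source, ih2, Set.mem_inter_iff, Set.mem_preimage,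
        ih1 x]
      simp [Rtheta, and_comm]

theorem RthetaAll_apply (x : State N K) : RthetaAll N K x = RthetaAllFun x := by
  rw [RthetaAll, (foldr_Rtheta _ (List.nodup_finRange N)).1 x]
  simp [RthetaAllFun]

theorem RthetaAll_source : (RthetaAll N K).source = {x | ∀ j, x.q j ≠ 0} := by
  rw [RthetaAll, (foldr_Rtheta _ (List.nodup_finRange N)).2]
  simp

theorem RthetaAll_symm_apply {x : State N K} (hx : ∀ j, x.q j ≠ 0) :
    (RthetaAll N K).symm x = RthetaAllFun x := by
  have h : RthetaAllFun x ∈ (RthetaAll N K).source := by rw [RthetaAll_source]; exact hx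
  have := (RthetaAll N K).left_inv h
  rwa [RthetaAll_apply, RthetaAllFun_RthetaAllFun] at this

theorem mem_RthetaAll_target {x : State N K} (hx : ∀ j, x.q j ≠ 0) :
    x ∈ (RthetaAll N K).target := by
  have h : RthetaAllFun x ∈ (RthetaAll N K).source := by rw [RthetaAll_source]; exact hx
  have := (RthetaAll N K).map_source h
  rwa [RthetaAll_apply, RthetaAllFun_RthetaAllFun] at this

theorem shift_apply (s : Fin N → ℂ) (x : State N K) :
    shift K s x = R1Fun (RtauFun s (RthetaAllFun (Rinf N K (R0Fun s x)))) := by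
  simp only [shift, PartialEquiv.trans_apply, RthetaAll_apply]
  rfl

theorem mem_shift_source (s : Fin N → ℂ) (x : State N K) :
    x ∈ (shift K s).source ↔
      ((∀ i, s i ≠ 0) ∧ ∑ j, x.q j / ι (s j) - 1 ≠ 0) ∧ (∀ j, x.q j ≠ 0) ∧
      RthetaAllFun (Rinf N K (R0Fun s x)) ∈ RtauDom s ∧
      ∑ j, (RtauFun s (RthetaAllFun (Rinf N K (R0Fun s x)))).q j - 1 ≠ 0 := by
  simp only [shift, PartialEquiv.trans_source, PartialEquiv.coe_trans, RthetaAll_source,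
    Set.mem_inter_iff, Set.mem_preimage, Function.comp_apply, RthetaAll_apply, and_assoc]
  simp [R0, Rinf, Rtau, R1, R0Fun, and_assoc]

/-- The Hamiltonians change under `l` only by the term `-q_i p_i / s_i`. -/
theorem ham_shift {s : Fin N → ℂ} (hs : Admissible s) (i : Fin N) {x : State N K}
    (hx : x ∈ (shift K s).source) :
    ham (shift K s x).par s i (shift K s x).q (shift K s x).p =
      ham x.par s i x.q x.p - x.q i * x.p i / ι (s i) := by
  obtain ⟨⟨-, hB⟩, hq, hτ, hA⟩ := (mem_shift_source s x).mp hx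
  rw [shift_apply, ham_R1Fun hs i _ hA, ham_RtauFun hs i _ hτ,
    ham_RthetaAllFun i _ (by exact hq), ham_Rinf, ham_R0Fun hs i _ hB]
  have hs0 := hs.algebraMap_ne_zero (K := K) i
  have hs1 := hs.algebraMap_sub_one_ne_zero (K := K) i
  have hqi := hq i
  -- At the stage where `R_τ` acts, the product is `q_i p_i - κ₀ q_i / (s_i B) - θ_i`, with `B` the
  -- denominator of `R_{κ₀}`. Its `κ₀` part cancels the extra term of `R_{κ₀}`, and its `θ_i` part
  -- cancels the sum of the constants from the other steps.
  simp only [RtauFun, RthetaAllFun, Rinf, R0Fun, PartialEquiv.coe_mk]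
  generalize ∑ j, x.q j / ι (s j) - 1 = B at hB ⊢
  simp only [map_sub, map_mul, map_add, map_neg, map_one, map_div₀]
  field_simp
  ring

/-- The products `q_i p_i` after `l⁻¹`, in terms of `x' = R_{κ₁}(x)`. -/
theorem shift_symm {s : Fin N → ℂ} (hs : Admissible s) (x : State N K)
    (h1 : ∑ j, x.q j - 1 ≠ 0) (h2 : R1Fun x ∈ RtauDom s) (h3 : ∀ j, (R1Fun x).p j ≠ 0)
    (h4 : tauDen (R1Fun x) - ∑ j, (R1Fun x).p j *
      ((R1Fun x).q j * (R1Fun x).p j - ι (x.par.θ j)) ≠ 0) :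
    x ∈ (shift K s).target ∧ ∀ i,
    ((shift K s).symm x).q i * ((shift K s).symm x).p i =
      -((R1Fun x).q i * (R1Fun x).p i) + ι (x.par.θ i) + ι (1 - x.par.κ0) *
        ((R1Fun x).p i * ((R1Fun x).q i * (R1Fun x).p i - ι (x.par.θ i))) /
        (tauDen (R1Fun x) - ∑ j, (R1Fun x).p j *
      ((R1Fun x).q j * (R1Fun x).p j - ι (x.par.θ j))) := by
  have hs0 := hs.algebraMap_ne_zero (K := K)
  obtain ⟨-, hD, hw⟩ := id h2
  have hm := RtauFun_mul s h2
  set y := R1Fun x with hy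
  have hθ : x.par.θ = y.par.θ := rfl
  have hκ : x.par.κ0 = y.par.κ0 := rfl
  rw [hκ]
  simp only [hθ] at h4 ⊢
  have hq : ∀ j, (RtauFun s y).q j ≠ 0 := fun j =>
    div_ne_zero (mul_ne_zero (mul_ne_zero (hs0 j) (h3 j)) (hw j)) hD
  have hqs : ∀ j, (RtauFun s y).q j / ι (s j) =
      y.p j * (y.q j * y.p j - ι (y.par.θ j)) / tauDen y := fun j => by
    have := hs0 j
    simp only [RtauFun]
    generalize y.q j * y.p j - ι (y.par.θ j) = w
    field_simp
  -- This is the denominator of `R_{κ₀}`, the last factor of `l⁻¹`. By `tauDen_R1Fun_sub` its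
  -- numerator is `F` divided by `∑ q_j - 1`, which is how `F` becomes the denominator of the second
  -- difference.
  have hB : ∑ j, (RtauFun s y).q j / ι (s j) - 1 =
      -(tauDen y - ∑ j, y.p j * (y.q j * y.p j - ι (y.par.θ j))) / tauDen y := by
    simp only [hqs, ← Finset.sum_div]
    field_simp
    ring
  have hB0 : ∑ j, (RtauFun s y).q j / ι (s j) - 1 ≠ 0 := by
    rw [hB]
    exact div_ne_zero (neg_ne_zero.mpr h4) hD
  have hsymm : (shift K s).symm x = R0Fun s (Rinf N K (RthetaAllFun (RtauFun s y))) := by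
    rw [← RthetaAll_symm_apply hq]
    rfl
  refine ⟨?_, fun i => ?_⟩
  · simp only [shift, PartialEquiv.trans_target, Set.mem_inter_iff, Set.mem_preimage]
    refine ⟨h1, h2, mem_RthetaAll_target hq, Set.mem_univ _, ?_⟩
    refine ⟨hs.ne_zero, ?_⟩
    change ∑ j, ((RthetaAll N K).symm (RtauFun s y)).q j / ι (s j) - 1 ≠ 0
    rw [RthetaAll_symm_apply hq]
    exact hB0
  · rw [hsymm]
    have e : (R0Fun s (Rinf N K (RthetaAllFun (RtauFun s y)))).q i *
        (R0Fun s (Rinf N K (RthetaAllFun (RtauFun s y)))).p i =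
        (RtauFun s y).q i * ((RtauFun s y).p i - ι (-y.par.θ i) / (RtauFun s y).q i -
          ι (-y.par.κ0 + 1) / (ι (s i) * (∑ j, (RtauFun s y).q j / ι (s j) - 1))) := rfl
    have e2 : (RtauFun s y).q i * ((RtauFun s y).p i - ι (-y.par.θ i) / (RtauFun s y).q i -
          ι (-y.par.κ0 + 1) / (ι (s i) * (∑ j, (RtauFun s y).q j / ι (s j) - 1))) =
        (RtauFun s y).q i * (RtauFun s y).p i + ι (y.par.θ i) - ι (-y.par.κ0 + 1) *
          ((RtauFun s y).q i / ι (s i)) / (∑ j, (RtauFun s y).q j / ι (s j) - 1) := by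
      have := hq i
      have := hs0 i
      rw [map_neg]
      field_simp
      ring
    rw [e, e2, hm, hqs, hB]
    generalize tauDen y - ∑ j, y.p j * (y.q j * y.p j - ι (y.par.θ j)) = Y at h4 ⊢
    generalize y.p i * (y.q i * y.p i - ι (y.par.θ i)) = u
    simp only [map_sub, map_add, map_neg, map_one]
    field_simp
    ring

/-- The polynomial in `(q, p)` whose value along a solution is `F`. -/
def todaPoly (x : State N K) : K :=
  -((∑ j, x.q j - 1) * (tauDen x - ∑ j, x.p j * (x.q j * x.p j - ι (x.par.θ j))))
    - ι (x.par.κ1 * (x.par.κ0 - 1))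

/-- The polynomial in `(q, p)` whose value along a solution is `∂F/∂s_i`. -/
def todaPolyDeriv (s : Fin N → ℂ) (i : Fin N) (x : State N K) : K :=
  (((∑ j, x.q j - 1) * (2 * (x.q i * x.p i) - ι (x.par.θ i)) - ι x.par.κ1 * x.q i) *
      (tauDen x - ∑ j, x.p j * (x.q j * x.p j - ι (x.par.θ j)))
    - ι (1 - x.par.κ0) * (∑ j, x.q j - 1) * (x.p i * (x.q i * x.p i - ι (x.par.θ i)))) / ι (s i)

theorem tauDen_R1Fun (x : State N K) (hA : ∑ j, x.q j - 1 ≠ 0) :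
    tauDen (R1Fun x) =
      (ι x.par.α + ∑ j, x.q j * x.p j - ι x.par.κ1 / (∑ j, x.q j - 1)) *
      (ι (x.par.α + x.par.κinf) + ∑ j, x.q j * x.p j - ι x.par.κ1 / (∑ j, x.q j - 1)) := by
  have hα : (R1Fun x).par.α = x.par.α + x.par.κ1 := by
    simp only [Params.α, R1Fun]; ring
  have hE : ∑ j, (R1Fun x).q j * (R1Fun x).p j =
      ∑ j, x.q j * x.p j - ι x.par.κ1 - ι x.par.κ1 / (∑ j, x.q j - 1) := by
    simp only [R1Fun, mul_sub, Finset.sum_sub_distrib, ← Finset.sum_mul]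
    field_simp
    ring
  simp only [tauDen, hE, hα]
  simp only [R1Fun, map_add]
  ring

/-- After multiplication by `A = ∑ q_j - 1`, the translation by `κ₁ / A` alters `A (D - V)` only by
a constant: the terms with `κ₁ / A` cancel and the relation between `α` and the parameters leaves
`κ₁ (κ₀ - 1)`. -/
theorem tauDen_R1Fun_sub (x : State N K) (hA : ∑ j, x.q j - 1 ≠ 0) :
    tauDen (R1Fun x) - ∑ j, (R1Fun x).p j *
      ((R1Fun x).q j * (R1Fun x).p j - ι (x.par.θ j)) = -todaPoly x / (∑ j, x.q j - 1) := by
  have hu : ∑ j, (R1Fun x).p j * ((R1Fun x).q j * (R1Fun x).p j - ι (x.par.θ j)) =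
      ∑ j, x.p j * (x.q j * x.p j - ι (x.par.θ j))
      - ι x.par.κ1 / (∑ j, x.q j - 1) * (2 * ∑ j, x.q j * x.p j - ∑ j, ι (x.par.θ j))
      + (ι x.par.κ1 / (∑ j, x.q j - 1)) ^ 2 * ∑ j, x.q j := by
    simp only [Finset.mul_sum, ← Finset.sum_sub_distrib, ← Finset.sum_add_distrib]
    refine Finset.sum_congr rfl fun j _ => ?_
    simp only [R1Fun]
    ring
  have hγ := congrArg ι x.par.two_mul_α_add
  simp only [map_add, map_sub, map_mul, map_ofNat, map_one, map_sum] at hγ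
  rw [tauDen_R1Fun x hA, hu, todaPoly, tauDen]
  have hg : ∑ j, x.q j = (∑ j, x.q j - 1) + 1 := by ring
  generalize ∑ j, x.q j - 1 = A at hA hg ⊢
  rw [hg]
  simp only [map_add, map_sub, map_mul, map_one]
  field_simp
  linear_combination (-A * ι x.par.κ1) * hγ

theorem ham_shift_sub_add {s : Fin N → ℂ} (hs : Admissible s) (i : Fin N) {x : State N K}
    (hx : x ∈ (shift K s).source)
    (h1 : ∑ j, x.q j - 1 ≠ 0) (h2 : R1Fun x ∈ RtauDom s) (h3 : ∀ j, (R1Fun x).p j ≠ 0)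
    (h4 : todaPoly x ≠ 0) :
    ham (shift K s x).par s i (shift K s x).q (shift K s x).p - 2 * ham x.par s i x.q x.p +
      ham ((shift K s).symm x).par s i ((shift K s).symm x).q ((shift K s).symm x).p =
      todaPolyDeriv s i x / todaPoly x := by
  have hY := tauDen_R1Fun_sub x h1
  obtain ⟨hmem, hsymm⟩ := shift_symm hs x h1 h2 h3
    (by rw [hY]; exact div_ne_zero (neg_ne_zero.mpr h4) h1)
  -- `ham_shift` at the preimage `l⁻¹(x)`, which `l` sends back to `x`.
  have hminus := ham_shift hs i ((shift K s).map_target hmem)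
  rw [(shift K s).right_inv hmem, hsymm i, hY] at hminus
  rw [ham_shift hs i hx]
  have hs0 := hs.algebraMap_ne_zero (K := K) i
  have hF : todaPoly x = -((∑ j, x.q j - 1) * (tauDen x - ∑ j, x.p j * (x.q j * x.p j -
    ι (x.par.θ j)))) - ι (x.par.κ1 * (x.par.κ0 - 1)) := rfl
  simp only [R1Fun] at hminus
  simp only [todaPolyDeriv]
  generalize todaPoly x = F at *
  generalize ∑ j, x.q j - 1 = A at *
  generalize tauDen x - ∑ j, x.p j * (x.q j * x.p j - ι (x.par.θ j)) = Y at *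
  generalize ham x.par s i x.q x.p = H at *
  generalize ham ((shift K s).symm x).par s i ((shift K s).symm x).q ((shift K s).symm x).p = H'
    at *
  have hH' := eq_add_of_sub_eq hminus.symm
  rw [hH']
  simp only [map_sub, map_mul, map_one] at hF ⊢
  field_simp
  linear_combination (-A * (2 * (x.q i * x.p i) - ι (x.par.θ i)) + x.q i * ι x.par.κ1) * hF

end Shift

/-! ### Closed forms for weighted sums of the Hamiltonians. -/

section ClosedForms

variable {N : ℕ}

/-- Exchanging `i` and `j` in half of the double sum collects the coefficients of `q_j u_i` and of
`e_j w_i` into the combinations in `h2` and `h1`. The coefficients `R`, `S` disappear and the double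
sums factor. The diagonal defect `1 + s_i ρ_i²` equals `ρ_i (s_i + 1)` by `h3` and absorbs the term
`(s_i + 1) w_i e_i`. -/
theorem sum_mul_hamNum {s : Fin N → ℂ} (D : ℂ) (d ρ q u e w : Fin N → ℂ)
    (h1 : ∀ i j, i ≠ j → coefR s j i * ρ j + coefR s i j * ρ i = 1)
    (h2 : ∀ i j, i ≠ j → coefS s i j * ρ i + coefR s i j * ρ j = s i * ρ i * ρ j)
    (h3 : ∀ i, (1 - ρ i) * (1 - s i * ρ i) = 0) (hu : ∀ i, q i * u i = e i * w i) :
    ∑ i, ρ i * hamNum s i D (d i) q u e w =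
      (∑ i, ρ i * q i) * D + (1 - ∑ i, ρ i * q i) * ∑ i, s i * ρ i * u i
        - (∑ i, e i) * (∑ i, w i) + ∑ i, ρ i * (d i * e i) := by
  have hpair : ∀ i j, ρ j * coefR s i j * (q j * u i) + ρ i * coefS s i j * (q j * u i)
      + (ρ i * coefR s i j + ρ j * coefR s j i) * (e j * w i) =
      ρ j * q j * (s i * ρ i * u i) + e j * w i
      - (if j = i then (1 + s i * ρ i ^ 2) * (w i * e i) else 0) := by
    intro i j
    by_cases hj : j = i
    · subst hj
      simp only [coefR_self, coefS_self, if_true]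
      linear_combination (-s j * ρ j ^ 2) * hu j
    · simp only [hj, if_false]
      linear_combination (e j * w i) * h1 i j (Ne.symm hj) + (q j * u i) * h2 i j (Ne.symm hj)
  have hswap : ∑ i, ∑ j, ρ i * (coefR s j i * (q i * u j) + coefS s i j * (q j * u i)
      + coefR s i j * (e j * w i + e i * w j)) =
      ∑ i, ∑ j, (ρ j * coefR s i j * (q j * u i) + ρ i * coefS s i j * (q j * u i)
      + (ρ i * coefR s i j + ρ j * coefR s j i) * (e j * w i)) := by
    have c1 : ∑ i, ∑ j, ρ i * (coefR s j i * (q i * u j)) =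
        ∑ i, ∑ j, ρ j * coefR s i j * (q j * u i) := by
      rw [Finset.sum_comm]
      simp only [mul_assoc]
    have c2 : ∑ i, ∑ j, ρ i * (coefR s i j * (e i * w j)) =
        ∑ i, ∑ j, ρ j * coefR s j i * (e j * w i) := by
      rw [Finset.sum_comm]
      simp only [mul_assoc]
    simp only [mul_add, add_mul, Finset.sum_add_distrib] at c1 c2 ⊢
    rw [c1, c2]
    simp only [mul_assoc]
  have hsum : ∑ i, ∑ j, ρ i * (coefR s j i * (q i * u j) + coefS s i j * (q j * u i)
      + coefR s i j * (e j * w i + e i * w j)) =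
      (∑ i, ρ i * q i) * (∑ i, s i * ρ i * u i) + (∑ i, e i) * (∑ i, w i)
        - ∑ i, (1 + s i * ρ i ^ 2) * (w i * e i) := by
    rw [hswap]
    simp only [hpair, Finset.sum_sub_distrib, Finset.sum_add_distrib, Finset.sum_ite_eq',
      Finset.mem_univ, if_true, ← Finset.sum_mul, ← Finset.mul_sum]
  have hterm : ∀ i, ρ i * hamNum s i D (d i) q u e w =
      ρ i * q i * D + s i * ρ i * u i - ∑ j, ρ i * (coefR s j i * (q i * u j)
        + coefS s i j * (q j * u i) + coefR s i j * (e j * w i + e i * w j))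
      - (1 + s i * ρ i ^ 2) * (w i * e i) + ρ i * (d i * e i) := by
    intro i
    rw [← Finset.mul_sum]
    simp only [hamNum, Algebra.algebraMap_self, RingHom.id_apply]
    linear_combination (w i * e i) * h3 i
  simp only [hterm, Finset.sum_sub_distrib, Finset.sum_add_distrib, hsum]
  rw [← Finset.sum_mul]
  ring

theorem ham_mul {s : Fin N → ℂ} (hs : Admissible s) (k : Params N) (i : Fin N)
    (q p : Fin N → ℂ) :
    s i * (s i - 1) * ham k s i q p = hamNum s i (quad k q p) (k.κ1 * s i + k.κ0 - 1) q
      (fun j => p j * (q j * p j - k.θ j)) (fun j => q j * p j) (fun j => q j * p j - k.θ j) := by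
  have h0 := hs.ne_zero i
  have h1 := sub_ne_zero.mpr (hs.ne_one i)
  rw [ham_eq]
  simp only [Algebra.algebraMap_self, RingHom.id_apply]
  field_simp

theorem sum_mul_ham {s : Fin N → ℂ} (hs : Admissible s) (k : Params N) (q p : Fin N → ℂ) :
    ∑ i, s i * (s i - 1) * ham k s i q p =
      (∑ i, q i - 1) * (quad k q p - ∑ i, s i * (p i * (q i * p i - k.θ i)))
        + k.κ1 * ∑ i, (s i - 1) * (q i * p i) + k.α * (k.α + k.κinf) := by
  have h := sum_mul_hamNum (s := s) (quad k q p) (fun i => k.κ1 * s i + k.κ0 - 1) (fun _ => 1) q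
    (fun j => p j * (q j * p j - k.θ j)) (fun j => q j * p j) (fun j => q j * p j - k.θ j)
    (fun i j hij => by simpa using coefR_add_coefR hs hij.symm)
    (fun i j hij => by simpa [add_comm] using coefR_add_coefS hs hij)
    (fun i => by ring) (fun i => by ring)
  have hd : ∑ i, 1 * ((k.κ1 * s i + k.κ0 - 1) * (q i * p i)) =
      k.κ1 * ∑ i, (s i - 1) * (q i * p i) + (k.κ1 + k.κ0 - 1) * ∑ i, q i * p i := by
    simp only [Finset.mul_sum, ← Finset.sum_add_distrib]
    exact Finset.sum_congr rfl fun i _ => by ring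
  rw [hd] at h
  simp only [one_mul, mul_one, Finset.sum_sub_distrib (fun i => q i * p i)] at h
  simp only [ham_mul hs]
  rw [h]
  simp only [quad, Algebra.algebraMap_self, RingHom.id_apply]
  linear_combination (∑ i, q i * p i) * k.two_mul_α_add

theorem sum_sub_one_mul_ham {s : Fin N → ℂ} (hs : Admissible s) (k : Params N)
    (q p : Fin N → ℂ) :
    ∑ i, (s i - 1) * ham k s i q p =
      (∑ i, q i / s i - 1) * (quad k q p - ∑ i, p i * (q i * p i - k.θ i))
        + (1 - k.κ0) * ∑ i, (1 - 1 / s i) * (q i * p i) + k.α * (k.α + k.κinf) := by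
  have h := sum_mul_hamNum (s := s) (quad k q p) (fun i => k.κ1 * s i + k.κ0 - 1)
    (fun i => 1 / s i) q
    (fun j => p j * (q j * p j - k.θ j)) (fun j => q j * p j) (fun j => q j * p j - k.θ j)
    (fun i j hij => by
      have := hs.ne_zero i
      have := hs.ne_zero j
      field_simp
      linear_combination coefR_mul_add_coefR_mul hs hij)
    (fun i j hij => by
      have := hs.ne_zero i
      have := hs.ne_zero j
      field_simp
      linear_combination coefR_mul_add_coefS_mul hs hij)
    (fun i => by have := hs.ne_zero i; field_simp; ring) (fun i => by ring)
  have hd : ∑ i, 1 / s i * ((k.κ1 * s i + k.κ0 - 1) * (q i * p i)) =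
      (1 - k.κ0) * ∑ i, (1 - 1 / s i) * (q i * p i) + (k.κ1 + k.κ0 - 1) * ∑ i, q i * p i := by
    simp only [Finset.mul_sum, ← Finset.sum_add_distrib]
    exact Finset.sum_congr rfl fun i _ => by have := hs.ne_zero i; field_simp; ring
  have hl : ∀ i, (s i - 1) * ham k s i q p = 1 / s i * (s i * (s i - 1) * ham k s i q p) :=
    fun i => by have := hs.ne_zero i; field_simp
  have hone : ∀ i, s i * (1 / s i) = 1 := fun i => by have := hs.ne_zero i; field_simp
  rw [hd] at h
  simp only [hone, one_mul, Finset.sum_sub_distrib (fun i => q i * p i), one_div_mul_eq_div] at h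
  simp only [hl, ham_mul hs, one_div_mul_eq_div]
  rw [h]
  simp only [quad, Algebra.algebraMap_self, RingHom.id_apply]
  linear_combination (∑ i, q i * p i) * k.two_mul_α_add

end ClosedForms

/-! ### Directional derivatives of a single Hamiltonian. -/

section Calculus

variable {N : ℕ}

/-- The derivative of `H_i` in the direction `(q', p')`, with `s` fixed, times `s_i (s_i - 1)`. -/
def hamLin (k : Params N) (s : Fin N → ℂ) (i : Fin N) (q p q' p' : Fin N → ℂ) : ℂ :=
  let e' : Fin N → ℂ := fun j => q' j * p j + q j * p' j
  let u' : Fin N → ℂ := fun j => q' j * p j ^ 2 + p' j * (2 * (q j * p j) - k.θ j)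
  q' i * quad k q p + q i * ((2 * k.α + k.κinf + 2 * ∑ j, q j * p j) * ∑ j, e' j) + s i * u' i
    - ∑ j, (coefR s j i * (q' i * (p j * (q j * p j - k.θ j)) + q i * u' j)
      + coefS s i j * (q' j * (p i * (q i * p i - k.θ i)) + q j * u' i)
      + coefR s i j * (e' j * (2 * (q i * p i) - k.θ i) + e' i * (2 * (q j * p j) - k.θ j)))
    - (s i + 1) * (e' i * (2 * (q i * p i) - k.θ i)) + (k.κ1 * s i + k.κ0 - 1) * e' i

variable {q p : ℂ → Fin N → ℂ} {q' p' : Fin N → ℂ} {t : ℂ}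

theorem hasDerivAt_mul (hq : ∀ j, HasDerivAt (fun t => q t j) (q' j) t)
    (hp : ∀ j, HasDerivAt (fun t => p t j) (p' j) t) (j : Fin N) :
    HasDerivAt (fun t => q t j * p t j) (q' j * p t j + q t j * p' j) t :=
  (hq j).mul (hp j)

theorem hasDerivAt_mul_mul (θ : ℂ) (hq : ∀ j, HasDerivAt (fun t => q t j) (q' j) t)
    (hp : ∀ j, HasDerivAt (fun t => p t j) (p' j) t) (j : Fin N) :
    HasDerivAt (fun t => p t j * (q t j * p t j - θ))
      (q' j * p t j ^ 2 + p' j * (2 * (q t j * p t j) - θ)) t := by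
  refine ((hp j).mul ((hasDerivAt_mul hq hp j).sub_const θ)).congr_deriv ?_
  ring

theorem hasDerivAt_quad (k : Params N) (hq : ∀ j, HasDerivAt (fun t => q t j) (q' j) t)
    (hp : ∀ j, HasDerivAt (fun t => p t j) (p' j) t) :
    HasDerivAt (fun t => quad k (q t) (p t))
      ((2 * k.α + k.κinf + 2 * ∑ j, q t j * p t j) * ∑ j, (q' j * p t j + q t j * p' j)) t := by
  have hE : HasDerivAt (fun t => ∑ j, q t j * p t j) (∑ j, (q' j * p t j + q t j * p' j)) t :=
    HasDerivAt.fun_sum fun j _ => hasDerivAt_mul hq hp j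
  simp only [quad, Algebra.algebraMap_self, RingHom.id_apply]
  refine ((hE.const_add k.α).mul (hE.const_add (k.α + k.κinf))).congr_deriv ?_
  ring

theorem hasDerivAt_ham (k : Params N) (s : Fin N → ℂ) (i : Fin N)
    (hq : ∀ j, HasDerivAt (fun t => q t j) (q' j) t)
    (hp : ∀ j, HasDerivAt (fun t => p t j) (p' j) t) :
    HasDerivAt (fun t => ham k s i (q t) (p t))
      (hamLin k s i (q t) (p t) q' p' / (s i * (s i - 1))) t := by
  simp only [ham_eq, hamNum, Algebra.algebraMap_self, RingHom.id_apply]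
  refine HasDerivAt.div_const ?_ _
  have hu := fun j => hasDerivAt_mul_mul (k.θ j) hq hp j
  have he := hasDerivAt_mul hq hp
  have hw := fun j => (he j).sub_const (k.θ j)
  have hsum : HasDerivAt (fun t => ∑ j, (coefR s j i * (q t i * (p t j * (q t j * p t j - k.θ j)))
      + coefS s i j * (q t j * (p t i * (q t i * p t i - k.θ i)))
      + coefR s i j * (q t j * p t j * (q t i * p t i - k.θ i)
        + q t i * p t i * (q t j * p t j - k.θ j)))) _ t :=
    HasDerivAt.fun_sum fun j _ => ((((hq i).mul (hu j)).const_mul _).add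
      (((hq j).mul (hu i)).const_mul _)).add
      ((((he j).mul (hw i)).add ((he i).mul (hw j))).const_mul _)
  refine ((((((hq i).mul (hasDerivAt_quad k hq hp)).add ((hu i).const_mul (s i))).sub hsum).sub
    (((hw i).mul (he i)).const_mul (s i + 1))).add
    ((he i).const_mul (k.κ1 * s i + k.κ0 - 1))).congr_deriv ?_
  simp only [hamLin]
  congr 1
  congr 1
  · congr 1
    refine Finset.sum_congr rfl fun j _ => ?_
    ring
  · ring

/-- This direction gives the bracket of `∑ q_j` with `H_i`. It and the next two directions suffice
to differentiate `F`. -/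
theorem hamLin_translation {s : Fin N → ℂ} (hs : Admissible s) (k : Params N) (i : Fin N)
    (q p : Fin N → ℂ) :
    hamLin k s i q p (fun _ => 0) (fun _ => 1) =
      (∑ j, q j - 1) * (q i * (2 * k.α + k.κinf + 2 * ∑ j, q j * p j)
        - s i * (2 * (q i * p i) - k.θ i)) + k.κ1 * (s i - 1) * q i := by
  have key : ∀ j, coefR s j i * (q i * (2 * (q j * p j) - k.θ j))
      + coefS s i j * (q j * (2 * (q i * p i) - k.θ i))
      + coefR s i j * (q j * (2 * (q i * p i) - k.θ i) + q i * (2 * (q j * p j) - k.θ j)) =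
      q i * (2 * (q j * p j) - k.θ j) + s i * (2 * (q i * p i) - k.θ i) * q j
      - (if j = i then (s i + 1) * (q i * (2 * (q i * p i) - k.θ i)) else 0) := by
    intro j
    by_cases hj : j = i
    · subst hj
      simp only [coefR_self, coefS_self, if_true]
      ring
    · simp only [hj, if_false]
      linear_combination (q i * (2 * (q j * p j) - k.θ j)) * coefR_add_coefR hs hj +
        (q j * (2 * (q i * p i) - k.θ i)) * coefR_add_coefS hs (Ne.symm hj)
  simp only [hamLin, zero_mul, zero_add, mul_one, one_mul]
  rw [Finset.sum_congr rfl fun j _ => key j]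
  simp only [Finset.sum_sub_distrib, Finset.sum_add_distrib, Finset.sum_ite_eq',
    Finset.mem_univ, if_true, ← Finset.mul_sum]
  linear_combination (q i) * k.two_mul_α_add

/-- Bracket with `∑ q_j p_j`, the generator of `q ↦ q/λ`, `p ↦ λp`. All terms of the numerator are
invariant except `q_i D`, of weight `-1`, and `s_i u_i`, of weight `1`. -/
theorem hamLin_dilation (k : Params N) (s : Fin N → ℂ) (i : Fin N) (q p : Fin N → ℂ) :
    hamLin k s i q p (fun j => -q j) p =
      s i * (p i * (q i * p i - k.θ i)) - q i * quad k q p := by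
  have key : ∀ j, coefR s j i * (-q i * (p j * (q j * p j - k.θ j))
        + q i * (-q j * p j ^ 2 + p j * (2 * (q j * p j) - k.θ j)))
      + coefS s i j * (-q j * (p i * (q i * p i - k.θ i))
        + q j * (-q i * p i ^ 2 + p i * (2 * (q i * p i) - k.θ i)))
      + coefR s i j * ((-q j * p j + q j * p j) * (2 * (q i * p i) - k.θ i)
        + (-q i * p i + q i * p i) * (2 * (q j * p j) - k.θ j)) = 0 := fun j => by ring
  simp only [hamLin]
  rw [Finset.sum_congr rfl fun j _ => key j]
  simp only [neg_mul, neg_add_cancel, Finset.sum_const_zero]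
  ring

/-- Bracket with `V = ∑ u_j`, where `u_j = p_j (q_j p_j - θ_j)`. In this direction every `u_j` is
stationary and `q_j p_j` has derivative `-u_j`. -/
theorem hamLin_special {s : Fin N → ℂ} (hs : Admissible s) (k : Params N) (i : Fin N)
    (q p : Fin N → ℂ) :
    hamLin k s i q p (fun j => -(2 * (q j * p j) - k.θ j)) (fun j => p j ^ 2) =
      (2 * (q i * p i) - k.θ i) * (∑ j, p j * (q j * p j - k.θ j) - quad k q p)
      - q i * (2 * k.α + k.κinf + 2 * ∑ j, q j * p j) * ∑ j, p j * (q j * p j - k.θ j)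
      + (s i * (2 * ∑ j, q j * p j - ∑ j, k.θ j) - (k.κ1 * s i + k.κ0 - 1)) *
        (p i * (q i * p i - k.θ i)) := by
  have he : ∀ j, -(2 * (q j * p j) - k.θ j) * p j + q j * p j ^ 2 =
      -(p j * (q j * p j - k.θ j)) := fun j => by ring
  have hu : ∀ j, -(2 * (q j * p j) - k.θ j) * p j ^ 2 + p j ^ 2 * (2 * (q j * p j) - k.θ j) = 0 :=
    fun j => by ring
  have key : ∀ j, coefR s j i * (-(2 * (q i * p i) - k.θ i) * (p j * (q j * p j - k.θ j))
        + q i * 0)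
      + coefS s i j * (-(2 * (q j * p j) - k.θ j) * (p i * (q i * p i - k.θ i)) + q j * 0)
      + coefR s i j * (-(p j * (q j * p j - k.θ j)) * (2 * (q i * p i) - k.θ i)
        + -(p i * (q i * p i - k.θ i)) * (2 * (q j * p j) - k.θ j)) =
      -(2 * (q i * p i) - k.θ i) * (p j * (q j * p j - k.θ j))
      - s i * (p i * (q i * p i - k.θ i)) * (2 * (q j * p j) - k.θ j)
      + (if j = i then (s i + 1) * (p i * (q i * p i - k.θ i) * (2 * (q i * p i) - k.θ i))
        else 0) := by
    intro j
    by_cases hj : j = i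
    · subst hj
      simp only [coefR_self, coefS_self, if_true]
      ring
    · simp only [hj, if_false]
      linear_combination (-(2 * (q i * p i) - k.θ i) * (p j * (q j * p j - k.θ j))) *
          coefR_add_coefR hs hj
        - (2 * (q j * p j) - k.θ j) * (p i * (q i * p i - k.θ i)) *
          coefR_add_coefS hs (Ne.symm hj)
  simp only [hamLin, he, hu]
  rw [Finset.sum_congr rfl fun j _ => key j]
  have hZ : ∑ j, (2 * (q j * p j) - k.θ j) = 2 * ∑ j, q j * p j - ∑ j, k.θ j := by
    rw [Finset.sum_sub_distrib, ← Finset.mul_sum]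
  simp only [Finset.sum_sub_distrib (fun _ => _ * _) (fun _ => _ * _ * _), Finset.sum_add_distrib,
    Finset.sum_ite_eq', Finset.mem_univ, if_true, ← Finset.mul_sum, Finset.sum_neg_distrib, hZ]
  ring

end Calculus

/-! ### Derivatives along a solution as Poisson brackets. -/

section Solutions

variable {N : ℕ}

theorem IsSolution.admissible {k : Params N} {U : Set (Fin N → ℂ)}
    {q p : (Fin N → ℂ) → Fin N → ℂ} (h : IsSolution k U q p) {s : Fin N → ℂ} (hs : s ∈ U) :
    Admissible s :=
  ⟨h.ne_zero s hs, h.ne_one s hs, h.ne_of_ne s hs⟩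

theorem hasDerivAt_add_smul {E F : Type*} [NormedAddCommGroup E] [NormedSpace ℂ E]
    [NormedAddCommGroup F] [NormedSpace ℂ F] {f : E → F} {x : E} (hf : DifferentiableAt ℂ f x)
    (v : E) : HasDerivAt (fun t : ℂ => f (x + t • v)) (fderiv ℂ f x v) 0 := by
  have hl : HasDerivAt (fun t : ℂ => x + t • v) v 0 := by
    simpa using ((hasDerivAt_id (0 : ℂ)).smul_const v).const_add x
  have hf' : HasFDerivAt f (fderiv ℂ f x) (x + (0 : ℂ) • v) := by
    simpa using hf.hasFDerivAt
  exact hf'.comp_hasDerivAt (0 : ℂ) hl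

theorem fderiv_apply_eq_sum_pd (f : (Fin N → ℂ) → ℂ) (x v : Fin N → ℂ) :
    fderiv ℂ f x v = ∑ j, v j * pd j f x := by
  conv_lhs => rw [pi_eq_sum_univ' v]
  simp only [map_sum, map_smul, smul_eq_mul, pd]

theorem differentiable_ham (k : Params N) (s : Fin N → ℂ) (i : Fin N) :
    Differentiable ℂ fun z : (Fin N → ℂ) × (Fin N → ℂ) => ham k s i z.1 z.2 := by
  simp only [ham]
  fun_prop

/-- The differential at `(q, p)` of the linear combination `∑ v_j H_j`. -/
def hamFD (k : Params N) (s v q p : Fin N → ℂ) :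
    ((Fin N → ℂ) × (Fin N → ℂ)) →L[ℂ] ℂ :=
  ∑ j, v j • fderiv ℂ (fun z : (Fin N → ℂ) × (Fin N → ℂ) => ham k s j z.1 z.2) (q, p)

theorem hasDerivAt_hamFD (k : Params N) (s v q p a b : Fin N → ℂ) :
    HasDerivAt (fun t : ℂ => ∑ j, v j * ham k s j (q + t • a) (p + t • b))
      (hamFD k s v q p (a, b)) 0 := by
  simp only [hamFD, _root_.sum_apply, _root_.smul_apply, smul_eq_mul]
  exact HasDerivAt.fun_sum fun j _ =>
    (hasDerivAt_add_smul (differentiable_ham k s j (q, p)) (a, b)).const_mul (v j)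

theorem pd_ham_p (k : Params N) (s : Fin N → ℂ) (j m : Fin N) (q p : Fin N → ℂ) :
    pd m (fun y => ham k s j q y) p =
      fderiv ℂ (fun z : (Fin N → ℂ) × (Fin N → ℂ) => ham k s j z.1 z.2) (q, p)
        (0, Pi.single m 1) := by
  have h1 : DifferentiableAt ℂ (fun y => ham k s j q y) p :=
    DifferentiableAt.comp (g := fun z : (Fin N → ℂ) × (Fin N → ℂ) => ham k s j z.1 z.2)
      (f := fun y => (q, y)) p (differentiable_ham k s j _) (by fun_prop)
  have h2 := hasDerivAt_add_smul (differentiable_ham k s j (q, p)) (0, Pi.single m 1)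
  have h3 := hasDerivAt_add_smul h1 (Pi.single m 1)
  simp only [Prod.smul_mk, smul_zero, Prod.mk_add_mk, add_zero] at h2
  exact h3.unique h2

theorem pd_ham_q (k : Params N) (s : Fin N → ℂ) (j m : Fin N) (q p : Fin N → ℂ) :
    pd m (fun x => ham k s j x p) q =
      fderiv ℂ (fun z : (Fin N → ℂ) × (Fin N → ℂ) => ham k s j z.1 z.2) (q, p)
        (Pi.single m 1, 0) := by
  have h1 : DifferentiableAt ℂ (fun x => ham k s j x p) q :=
    DifferentiableAt.comp (g := fun z : (Fin N → ℂ) × (Fin N → ℂ) => ham k s j z.1 z.2)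
      (f := fun x => (x, p)) q (differentiable_ham k s j _) (by fun_prop)
  have h2 := hasDerivAt_add_smul (differentiable_ham k s j (q, p)) (Pi.single m 1, 0)
  have h3 := hasDerivAt_add_smul h1 (Pi.single m 1)
  simp only [Prod.smul_mk, smul_zero, Prod.mk_add_mk, add_zero] at h2
  exact h3.unique h2

variable {k : Params N} {U : Set (Fin N → ℂ)} {q p : (Fin N → ℂ) → Fin N → ℂ}

theorem IsSolution.differentiableAt_q (h : IsSolution k U q p) {s : Fin N → ℂ} (hs : s ∈ U)
    (m : Fin N) : DifferentiableAt ℂ (fun t => q t m) s :=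
  differentiableAt_pi.mp (h.differentiableOn_q.differentiableAt (h.isOpen.mem_nhds hs)) m

theorem IsSolution.differentiableAt_p (h : IsSolution k U q p) {s : Fin N → ℂ} (hs : s ∈ U)
    (m : Fin N) : DifferentiableAt ℂ (fun t => p t m) s :=
  differentiableAt_pi.mp (h.differentiableOn_p.differentiableAt (h.isOpen.mem_nhds hs)) m

theorem IsSolution.hasDerivAt_q (h : IsSolution k U q p) {s : Fin N → ℂ} (hs : s ∈ U)
    (v : Fin N → ℂ) (m : Fin N) :
    HasDerivAt (fun t : ℂ => q (s + t • v) m) (hamFD k s v (q s) (p s) (0, Pi.single m 1)) 0 := by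
  refine (hasDerivAt_add_smul (h.differentiableAt_q hs m) v).congr_deriv ?_
  simp only [fderiv_apply_eq_sum_pd, h.eq_q s hs, pd_ham_p, hamFD, _root_.sum_apply,
    _root_.smul_apply, smul_eq_mul]

theorem IsSolution.hasDerivAt_p (h : IsSolution k U q p) {s : Fin N → ℂ} (hs : s ∈ U)
    (v : Fin N → ℂ) (m : Fin N) :
    HasDerivAt (fun t : ℂ => p (s + t • v) m)
      (-hamFD k s v (q s) (p s) (Pi.single m 1, 0)) 0 := by
  refine (hasDerivAt_add_smul (h.differentiableAt_p hs m) v).congr_deriv ?_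
  simp only [fderiv_apply_eq_sum_pd, h.eq_p s hs, pd_ham_q, hamFD, _root_.sum_apply,
    _root_.smul_apply, smul_eq_mul, mul_neg, Finset.sum_neg_distrib]

/-- The Poisson bracket with `∑ v_j H_j` of a function with partial derivatives `a` in `q` and `b`
in `p`. -/
theorem sum_hamFD (k : Params N) (s v q p a b : Fin N → ℂ) :
    ∑ m, (a m * hamFD k s v q p (0, Pi.single m 1) + b m * -hamFD k s v q p (Pi.single m 1, 0)) =
      hamFD k s v q p (fun j => -b j, a) := by
  have hab : ((fun j => -b j, a) : (Fin N → ℂ) × (Fin N → ℂ)) =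
      ∑ m, (a m • (0, Pi.single m 1) + -b m • (Pi.single m 1, 0)) := by
    ext j
    · simp [Prod.fst_sum, Finset.sum_apply, Pi.single_apply]
    · simp [Prod.snd_sum, Finset.sum_apply, Pi.single_apply]
  rw [hab, map_sum]
  refine Finset.sum_congr rfl fun m _ => ?_
  rw [map_add, map_smul, map_smul, smul_eq_mul, smul_eq_mul]
  ring

theorem hasDerivAt_line (x v : Fin N → ℂ) (j : Fin N) :
    HasDerivAt (fun t : ℂ => (x + t • v) j) (v j) 0 := by
  simpa using ((hasDerivAt_id (0 : ℂ)).mul_const (v j)).const_add (x j)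

theorem hamFD_single (k : Params N) (s : Fin N → ℂ) (i : Fin N) (q p a b : Fin N → ℂ) :
    hamFD k s (Pi.single i 1) q p (a, b) = hamLin k s i q p a b / (s i * (s i - 1)) := by
  have h1 := hasDerivAt_hamFD k s (Pi.single i 1) q p a b
  have h2 := hasDerivAt_ham k s i (hasDerivAt_line q a) (hasDerivAt_line p b)
  simp only [Pi.single_apply, ite_mul, one_mul, zero_mul, Finset.sum_ite_eq', Finset.mem_univ,
    if_true] at h1
  simpa using h1.unique h2

/-- Differentiating the closed form of `∑ (s_j - 1) H_j` avoids the coefficients `R` and `S`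
altogether. -/
theorem hamFD_sub_one {s : Fin N → ℂ} (hs : Admissible s) (k : Params N) (q p a b : Fin N → ℂ) :
    hamFD k s (fun j => s j - 1) q p (a, b) =
      (∑ j, a j / s j) * (quad k q p - ∑ j, p j * (q j * p j - k.θ j))
      + (∑ j, q j / s j - 1) *
        ((2 * k.α + k.κinf + 2 * ∑ j, q j * p j) * ∑ j, (a j * p j + q j * b j)
          - ∑ j, (a j * p j ^ 2 + b j * (2 * (q j * p j) - k.θ j)))
      + (1 - k.κ0) * ∑ j, (1 - 1 / s j) * (a j * p j + q j * b j) := by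
  have h1 := hasDerivAt_hamFD k s (fun j => s j - 1) q p a b
  simp only [sum_sub_one_mul_ham hs] at h1
  have hq := hasDerivAt_line q a
  have hp := hasDerivAt_line p b
  have hB : HasDerivAt (fun t : ℂ => ∑ j, (q + t • a) j / s j - 1) (∑ j, a j / s j) 0 :=
    (HasDerivAt.fun_sum fun j _ => (hq j).div_const (s j)).sub_const 1
  have hU : HasDerivAt (fun t : ℂ => ∑ j, (p + t • b) j * ((q + t • a) j * (p + t • b) j - k.θ j))
      (∑ j, (a j * (p + (0 : ℂ) • b) j ^ 2 + b j * (2 * ((q + (0 : ℂ) • a) j *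
        (p + (0 : ℂ) • b) j) - k.θ j))) 0 :=
    HasDerivAt.fun_sum fun j _ => hasDerivAt_mul_mul (k.θ j) hq hp j
  have hL : HasDerivAt (fun t : ℂ => ∑ j, (1 - 1 / s j) * ((q + t • a) j * (p + t • b) j))
      (∑ j, (1 - 1 / s j) * (a j * (p + (0 : ℂ) • b) j + (q + (0 : ℂ) • a) j * b j)) 0 :=
    HasDerivAt.fun_sum fun j _ => (hasDerivAt_mul hq hp j).const_mul _
  have h2 := ((hB.mul ((hasDerivAt_quad k hq hp).sub hU)).add
    (hL.const_mul (1 - k.κ0))).add_const (k.α * (k.α + k.κinf))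
  have h3 := h1.unique h2
  simp only [zero_smul, add_zero, Pi.add_apply, Pi.sub_apply, Pi.zero_apply] at h3
  exact h3

end Solutions

/-! ### `F` and its derivatives along a solution. -/

section Toda

variable {N : ℕ} {k : Params N} {U : Set (Fin N → ℂ)} {q p : (Fin N → ℂ) → Fin N → ℂ}

theorem Admissible.differentiableAt_coefR {s : Fin N → ℂ} (hs : Admissible s) (i j : Fin N) :
    DifferentiableAt ℂ (fun t : Fin N → ℂ => coefR t i j) s := by
  by_cases h : i = j
  · subst h
    simp only [coefR_self]
    fun_prop
  · have := sub_ne_zero.mpr (hs.ne_of_ne j i (Ne.symm h))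
    simp only [coefR]
    fun_prop (disch := assumption)

theorem Admissible.differentiableAt_coefS {s : Fin N → ℂ} (hs : Admissible s) (i j : Fin N) :
    DifferentiableAt ℂ (fun t : Fin N → ℂ => coefS t i j) s := by
  by_cases h : i = j
  · subst h
    simp only [coefS_self]
    fun_prop
  · have := sub_ne_zero.mpr (hs.ne_of_ne i j h)
    simp only [coefS]
    fun_prop (disch := assumption)

theorem IsSolution.differentiableAt_hamAlong (h : IsSolution k U q p) {s : Fin N → ℂ}
    (hs : s ∈ U) (i : Fin N) : DifferentiableAt ℂ (hamAlong k q p i) s := by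
  have hR := (h.admissible hs).differentiableAt_coefR
  have hS := (h.admissible hs).differentiableAt_coefS
  have hq := h.differentiableAt_q hs
  have hp := h.differentiableAt_p hs
  have hT : s i * (s i - 1) ≠ 0 :=
    mul_ne_zero (h.ne_zero s hs i) (sub_ne_zero.mpr (h.ne_one s hs i))
  have he : hamAlong k q p i = fun t => ham k t i (q t) (p t) := rfl
  rw [he]
  simp only [ham_eq, hamNum, quad, Algebra.algebraMap_self, RingHom.id_apply]
  fun_prop (disch := assumption)

theorem IsSolution.eventually_mem (h : IsSolution k U q p) {s : Fin N → ℂ} (hs : s ∈ U)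
    (v : Fin N → ℂ) : ∀ᶠ t : ℂ in nhds 0, s + t • v ∈ U := by
  have hc : Continuous fun t : ℂ => s + t • v := by fun_prop
  exact hc.continuousAt.eventually_mem (h.isOpen.mem_nhds (by simpa using hs))

/-- Bracket of `∑ q_j` with `∑ (s_j - 1) H_j`. The direction is written with `-0` because
`sum_hamFD` produces it in this form from `b = 0`. -/
theorem hamFD_sub_one_translation {s : Fin N → ℂ} (hs : Admissible s) (k : Params N)
    (q p : Fin N → ℂ) :
    hamFD k s (fun j => s j - 1) q p (fun _ => -0, fun _ => 1) =
      (∑ j, q j / s j - 1) *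
        ((∑ j, q j - 1) * (2 * k.α + k.κinf + 2 * ∑ j, q j * p j) - k.κ1)
      + (1 - k.κ0) * (∑ j, q j - 1) := by
  have e1 : ∑ j, (1 - 1 / s j) * (-0 * p j + q j * 1) = ∑ j, q j - ∑ j, q j / s j := by
    rw [← Finset.sum_sub_distrib]
    exact Finset.sum_congr rfl fun j _ => by ring
  have e2 : ∑ j, (-0 * p j ^ 2 + 1 * (2 * (q j * p j) - k.θ j)) =
      2 * ∑ j, q j * p j - ∑ j, k.θ j := by
    rw [Finset.mul_sum, ← Finset.sum_sub_distrib]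
    exact Finset.sum_congr rfl fun j _ => by ring
  have e3 : ∑ j, (-0 * p j + q j * 1) = ∑ j, q j := Finset.sum_congr rfl fun j _ => by ring
  have e4 : ∑ j, -0 / s j = 0 := by simp
  rw [hamFD_sub_one hs, e1, e2, e3, e4]
  linear_combination (∑ j, q j / s j - 1) * k.two_mul_α_add

theorem hamFD_sub_one_dilation {s : Fin N → ℂ} (hs : Admissible s) (k : Params N)
    (q p : Fin N → ℂ) :
    hamFD k s (fun j => s j - 1) q p (fun j => -q j, p) =
      -(∑ j, q j / s j - 1) * quad k q p - (quad k q p - ∑ j, p j * (q j * p j - k.θ j)) := by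
  have e1 : ∑ j, (1 - 1 / s j) * (-q j * p j + q j * p j) = 0 :=
    Finset.sum_eq_zero fun j _ => by ring
  have e2 : ∑ j, (-q j * p j ^ 2 + p j * (2 * (q j * p j) - k.θ j)) =
      ∑ j, p j * (q j * p j - k.θ j) := Finset.sum_congr rfl fun j _ => by ring
  have e3 : ∑ j, (-q j * p j + q j * p j) = 0 := Finset.sum_eq_zero fun j _ => by ring
  have e4 : ∑ j, -q j / s j = -∑ j, q j / s j := by
    rw [← Finset.sum_neg_distrib]
    exact Finset.sum_congr rfl fun j _ => by ring
  rw [hamFD_sub_one hs, e1, e2, e3, e4]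
  ring

/-- Bracket with `∑ s_j p_j (q_j p_j - θ_j)`, which occurs in the closed form of `∑ s_k (s_k - 1)
H_k`. -/
theorem hamFD_sub_one_special {s : Fin N → ℂ} (hs : Admissible s) (k : Params N)
    (q p : Fin N → ℂ) :
    hamFD k s (fun j => s j - 1) q p
        (fun j => -(s j * (2 * (q j * p j) - k.θ j)), fun j => s j * p j ^ 2) =
      -(2 * ∑ j, q j * p j - ∑ j, k.θ j) * (quad k q p - ∑ j, p j * (q j * p j - k.θ j))
      - (∑ j, q j / s j - 1) * (2 * k.α + k.κinf + 2 * ∑ j, q j * p j) *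
        ∑ j, s j * (p j * (q j * p j - k.θ j))
      - (1 - k.κ0) * (∑ j, s j * (p j * (q j * p j - k.θ j))
        - ∑ j, p j * (q j * p j - k.θ j)) := by
  have e1 : ∑ j, (1 - 1 / s j) * (-(s j * (2 * (q j * p j) - k.θ j)) * p j
      + q j * (s j * p j ^ 2)) = ∑ j, p j * (q j * p j - k.θ j)
        - ∑ j, s j * (p j * (q j * p j - k.θ j)) := by
    rw [← Finset.sum_sub_distrib]
    refine Finset.sum_congr rfl fun j _ => ?_
    have := hs.ne_zero j
    field_simp
    ring
  have e2 : ∑ j, (-(s j * (2 * (q j * p j) - k.θ j)) * p j ^ 2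
      + s j * p j ^ 2 * (2 * (q j * p j) - k.θ j)) = 0 :=
    Finset.sum_eq_zero fun j _ => by ring
  have e3 : ∑ j, (-(s j * (2 * (q j * p j) - k.θ j)) * p j + q j * (s j * p j ^ 2)) =
      -∑ j, s j * (p j * (q j * p j - k.θ j)) := by
    rw [← Finset.sum_neg_distrib]
    exact Finset.sum_congr rfl fun j _ => by ring
  have e4 : ∑ j, -(s j * (2 * (q j * p j) - k.θ j)) / s j =
      -(2 * ∑ j, q j * p j - ∑ j, k.θ j) := by
    rw [Finset.mul_sum, ← Finset.sum_sub_distrib, ← Finset.sum_neg_distrib]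
    refine Finset.sum_congr rfl fun j _ => ?_
    have := hs.ne_zero j
    field_simp
  rw [hamFD_sub_one hs, e1, e2, e3, e4]
  ring

/-- Bracket with `∑ (s_j - 1) q_j p_j`, the factor of `κ₁` in the same closed form. -/
theorem hamFD_sub_one_weighted_dilation {s : Fin N → ℂ} (hs : Admissible s) (k : Params N)
    (q p : Fin N → ℂ) :
    hamFD k s (fun j => s j - 1) q p (fun j => -((s j - 1) * q j), fun j => (s j - 1) * p j) =
      (∑ j, q j / s j - ∑ j, q j) * (quad k q p - ∑ j, p j * (q j * p j - k.θ j))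
      - (∑ j, q j / s j - 1) * (∑ j, s j * (p j * (q j * p j - k.θ j))
        - ∑ j, p j * (q j * p j - k.θ j)) := by
  have e1 : ∑ j, (1 - 1 / s j) * (-((s j - 1) * q j) * p j + q j * ((s j - 1) * p j)) = 0 :=
    Finset.sum_eq_zero fun j _ => by ring
  have e2 : ∑ j, (-((s j - 1) * q j) * p j ^ 2 + (s j - 1) * p j * (2 * (q j * p j) - k.θ j)) =
      ∑ j, s j * (p j * (q j * p j - k.θ j)) - ∑ j, p j * (q j * p j - k.θ j) := by
    rw [← Finset.sum_sub_distrib]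
    exact Finset.sum_congr rfl fun j _ => by ring
  have e3 : ∑ j, (-((s j - 1) * q j) * p j + q j * ((s j - 1) * p j)) = 0 :=
    Finset.sum_eq_zero fun j _ => by ring
  have e4 : ∑ j, -((s j - 1) * q j) / s j = ∑ j, q j / s j - ∑ j, q j := by
    rw [← Finset.sum_sub_distrib]
    refine Finset.sum_congr rfl fun j _ => ?_
    have := hs.ne_zero j
    field_simp
    ring
  rw [hamFD_sub_one hs, e1, e2, e3, e4]
  ring

theorem IsSolution.todaF_eq (h : IsSolution k U q p) {s : Fin N → ℂ} (hs : s ∈ U) :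
    todaF k q p s = todaPoly ⟨k, q s, p s⟩ := by
  have hadm := h.admissible hs
  -- The vector field `∑ (s_j - 1) ∂/∂s_j` is frozen at `s`, so its action becomes an ordinary
  -- derivative at `0` along a line.
  set v : Fin N → ℂ := fun j => s j - 1 with hv
  have hdiff : DifferentiableAt ℂ (fun t => ∑ m, t m * (t m - 1) * hamAlong k q p m t) s := by
    have := h.differentiableAt_hamAlong hs
    fun_prop
  have hd := hasDerivAt_add_smul hdiff v
  rw [fderiv_apply_eq_sum_pd] at hd
  have hq := h.hasDerivAt_q hs v
  have hp := h.hasDerivAt_p hs v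
  have hl := hasDerivAt_line s v
  have hg : HasDerivAt (fun t : ℂ => ∑ j, q (s + t • v) j - 1)
      (∑ j, hamFD k s v (q s) (p s) (0, Pi.single j 1)) 0 :=
    (HasDerivAt.fun_sum fun j _ => hq j).sub_const 1
  have hU : HasDerivAt (fun t : ℂ => ∑ j, (s + t • v) j *
      (p (s + t • v) j * (q (s + t • v) j * p (s + t • v) j - k.θ j))) _ 0 :=
    HasDerivAt.fun_sum fun j _ => (hl j).mul (hasDerivAt_mul_mul (k.θ j) hq hp j)
  have hM : HasDerivAt (fun t : ℂ => ∑ j, ((s + t • v) j - 1) *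
      (q (s + t • v) j * p (s + t • v) j)) _ 0 :=
    HasDerivAt.fun_sum fun j _ => ((hl j).sub_const 1).mul (hasDerivAt_mul hq hp j)
  have hclosed := ((hg.mul ((hasDerivAt_quad k hq hp).sub hU)).add
    (hM.const_mul k.κ1)).add_const (k.α * (k.α + k.κinf))
  have heq : (fun t : ℂ => ∑ m, (s + t • v) m * ((s + t • v) m - 1) *
      hamAlong k q p m (s + t • v)) =ᶠ[nhds 0] fun t : ℂ =>
      (∑ j, q (s + t • v) j - 1) * (quad k (q (s + t • v)) (p (s + t • v))
        - ∑ j, (s + t • v) j * (p (s + t • v) j * (q (s + t • v) j * p (s + t • v) j - k.θ j)))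
      + k.κ1 * ∑ j, ((s + t • v) j - 1) * (q (s + t • v) j * p (s + t • v) j)
      + k.α * (k.α + k.κinf) := by
    filter_upwards [h.eventually_mem hs v] with t ht
    exact sum_mul_ham (h.admissible ht) k _ _
  have key := hd.unique (hclosed.congr_of_eventuallyEq heq)
  simp only [zero_smul, add_zero, Pi.sub_apply] at key
  have b1 : ∑ j, hamFD k s v (q s) (p s) (0, Pi.single j 1) = _ :=
    (Finset.sum_congr rfl fun j _ => by ring).trans
      ((sum_hamFD k s v (q s) (p s) (fun _ => 1) (fun _ => 0)).trans
        (hamFD_sub_one_translation hadm k (q s) (p s)))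
  have b2 : ∑ j, (hamFD k s v (q s) (p s) (0, Pi.single j 1) * p s j +
      q s j * -hamFD k s v (q s) (p s) (Pi.single j 1, 0)) = _ :=
    (Finset.sum_congr rfl fun j _ => by ring).trans
      ((sum_hamFD k s v (q s) (p s) (p s) (q s)).trans
        (hamFD_sub_one_dilation hadm k (q s) (p s)))
  have b3 : ∑ j, s j * (hamFD k s v (q s) (p s) (0, Pi.single j 1) * p s j ^ 2 +
      -hamFD k s v (q s) (p s) (Pi.single j 1, 0) * (2 * (q s j * p s j) - k.θ j)) = _ :=
    (Finset.sum_congr rfl fun j _ => by ring).trans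
      ((sum_hamFD k s v (q s) (p s) (fun j => s j * p s j ^ 2)
        (fun j => s j * (2 * (q s j * p s j) - k.θ j))).trans
        (hamFD_sub_one_special hadm k (q s) (p s)))
  have b4 : ∑ j, (s j - 1) * (hamFD k s v (q s) (p s) (0, Pi.single j 1) * p s j +
      q s j * -hamFD k s v (q s) (p s) (Pi.single j 1, 0)) = _ :=
    (Finset.sum_congr rfl fun j _ => by ring).trans
      ((sum_hamFD k s v (q s) (p s) (fun j => (s j - 1) * p s j)
        (fun j => (s j - 1) * q s j)).trans
        (hamFD_sub_one_weighted_dilation hadm k (q s) (p s)))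
  have hvu : ∑ j, v j * (p s j * (q s j * p s j - k.θ j)) =
      ∑ j, s j * (p s j * (q s j * p s j - k.θ j)) - ∑ j, p s j * (q s j * p s j - k.θ j) := by
    rw [← Finset.sum_sub_distrib]
    exact Finset.sum_congr rfl fun j _ => by rw [hv]; ring
  rw [b1, b2, Finset.sum_add_distrib,
    Finset.sum_add_distrib (f := fun j => v j * (q s j * p s j)), b3, b4, hvu] at key
  have hh : ∑ m, s m * (s m - 1) * hamAlong k q p m s = _ := sum_mul_ham hadm k (q s) (p s)
  have hD : tauDen (⟨k, q s, p s⟩ : State N ℂ) = quad k (q s) (p s) := rfl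
  simp only [todaF, todaPoly, hD, Algebra.algebraMap_self, RingHom.id_apply]
  rw [hh]
  change ∑ j, v j * _ - _ - _ + _ = _
  rw [key]
  change _ + k.κ1 * (∑ j, (s j - 1) * (q s j * p s j) + _) - _ - _ + _ = _
  -- All bracket terms cancel. From the explicit dependence on `s`, the derivative keeps `-A ∑ (s_j
  -- - 1) u_j + κ₁ ∑ (s_j - 1) q_j p_j`, with `u_j = p_j (q_j p_j - θ_j)`. Subtracting the sum
  -- itself leaves `-A (D - V)` and constants.
  linear_combination ((∑ j, q s j - 1) * (quad k (q s) (p s)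
    - ∑ j, p s j * (q s j * p s j - k.θ j))) * (-k.two_mul_α_add)

theorem IsSolution.differentiableOn_todaF (h : IsSolution k U q p) :
    DifferentiableOn ℂ (todaF k q p) U := by
  have hc : DifferentiableOn ℂ (fun s => todaPoly (⟨k, q s, p s⟩ : State N ℂ)) U := by
    intro s hs
    have hq := h.differentiableAt_q hs
    have hp := h.differentiableAt_p hs
    refine DifferentiableAt.differentiableWithinAt ?_
    simp only [todaPoly, tauDen]
    fun_prop
  exact hc.congr fun s hs => h.todaF_eq hs

theorem IsSolution.pd_todaF (h : IsSolution k U q p) {s : Fin N → ℂ} (hs : s ∈ U) (i : Fin N) :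
    pd i (todaF k q p) s = todaPolyDeriv s i ⟨k, q s, p s⟩ := by
  have hadm := h.admissible hs
  have hd := hasDerivAt_add_smul
    (h.differentiableOn_todaF.differentiableAt (h.isOpen.mem_nhds hs)) (Pi.single i 1)
  set v : Fin N → ℂ := Pi.single i 1 with hv
  have hq := h.hasDerivAt_q hs v
  have hp := h.hasDerivAt_p hs v
  have hg : HasDerivAt (fun t : ℂ => ∑ j, q (s + t • v) j - 1)
      (∑ j, hamFD k s v (q s) (p s) (0, Pi.single j 1)) 0 :=
    (HasDerivAt.fun_sum fun j _ => hq j).sub_const 1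
  have hU : HasDerivAt (fun t : ℂ => ∑ j,
      (p (s + t • v) j * (q (s + t • v) j * p (s + t • v) j - k.θ j))) _ 0 :=
    HasDerivAt.fun_sum fun j _ => hasDerivAt_mul_mul (k.θ j) hq hp j
  have hclosed := ((hg.mul ((hasDerivAt_quad k hq hp).sub hU)).neg).sub_const (k.κ1 * (k.κ0 - 1))
  have heq : (fun t : ℂ => todaF k q p (s + t • v)) =ᶠ[nhds 0] fun t : ℂ =>
      -((∑ j, q (s + t • v) j - 1) * (quad k (q (s + t • v)) (p (s + t • v))
        - ∑ j, p (s + t • v) j * (q (s + t • v) j * p (s + t • v) j - k.θ j)))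
      - k.κ1 * (k.κ0 - 1) := by
    filter_upwards [h.eventually_mem hs v] with t ht
    exact h.todaF_eq ht
  have key := hd.unique (hclosed.congr_of_eventuallyEq heq)
  simp only [zero_smul, add_zero, Pi.sub_apply] at key
  have b1 : ∑ j, hamFD k s v (q s) (p s) (0, Pi.single j 1) = _ :=
    (Finset.sum_congr rfl fun j _ => by ring).trans
      ((sum_hamFD k s v (q s) (p s) (fun _ => 1) (fun _ => 0)).trans
        (hamFD_single k s i (q s) (p s) _ _))
  have b2 : ∑ j, (hamFD k s v (q s) (p s) (0, Pi.single j 1) * p s j +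
      q s j * -hamFD k s v (q s) (p s) (Pi.single j 1, 0)) = _ :=
    (Finset.sum_congr rfl fun j _ => by ring).trans
      ((sum_hamFD k s v (q s) (p s) (p s) (q s)).trans (hamFD_single k s i (q s) (p s) _ _))
  have b3 : ∑ j, (hamFD k s v (q s) (p s) (0, Pi.single j 1) * p s j ^ 2 +
      -hamFD k s v (q s) (p s) (Pi.single j 1, 0) * (2 * (q s j * p s j) - k.θ j)) = _ :=
    (Finset.sum_congr rfl fun j _ => by ring).trans
      ((sum_hamFD k s v (q s) (p s) (fun j => p s j ^ 2)
        (fun j => 2 * (q s j * p s j) - k.θ j)).trans (hamFD_single k s i (q s) (p s) _ _))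
  rw [hamLin_dilation] at b2
  rw [hamLin_special hadm] at b3
  simp only [neg_zero] at b1
  rw [hamLin_translation hadm] at b1
  rw [b1, b2, b3] at key
  have hD : tauDen (⟨k, q s, p s⟩ : State N ℂ) = quad k (q s) (p s) := rfl
  simp only [todaPolyDeriv, hD, Algebra.algebraMap_self, RingHom.id_apply]
  rw [pd, ← hv, key]
  have h0 := hadm.ne_zero i
  have h1 := sub_ne_zero.mpr (hadm.ne_one i)
  have hγ := k.two_mul_α_add
  generalize ∑ j, q s j - 1 = A
  generalize ∑ j, p s j * (q s j * p s j - k.θ j) = V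
  generalize quad k (q s) (p s) = D
  generalize ∑ j, q s j * p s j = E at *
  generalize ∑ j, k.θ j = Θ at *
  have hΘ : Θ = 1 - k.κ0 - k.κ1 - (2 * k.α + k.κinf) := by rw [hγ]; ring
  rw [hΘ]
  field_simp
  ring

end Toda

/-! ### Values of rational functions at a point. -/

section Values

variable {N : ℕ} {q p : Fin N → ℂ} {r r' : PhaseField N} {v v' : ℂ}

theorem algebraMap_ne_zero_of_eval_ne_zero {b : PhasePoly N} (hb : MvPolynomial.eval (Sum.elim q p) b ≠ 0) :
    algebraMap (PhasePoly N) (PhaseField N) b ≠ 0 := by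
  intro h0
  rw [FaithfulSMul.algebraMap_eq_zero_iff] at h0
  exact hb (by rw [h0, map_zero])

/-- Cross-multiplication gives an identity of polynomials, which can be evaluated. This transfers
identities in `ℂ(q, p)` to points of a solution. -/
theorem HasValueAt.unique (h : HasValueAt r q p v) (h' : HasValueAt r q p v') : v = v' := by
  obtain ⟨a, b, hb, rfl, rfl⟩ := h
  obtain ⟨a', b', hb', hr, rfl⟩ := h'
  rw [div_eq_div_iff (algebraMap_ne_zero_of_eval_ne_zero hb) (algebraMap_ne_zero_of_eval_ne_zero hb'), ← map_mul, ← map_mul] at hr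
  have := congrArg (MvPolynomial.eval (Sum.elim q p))
    (FaithfulSMul.algebraMap_injective (PhasePoly N) (PhaseField N) hr)
  rw [map_mul, map_mul] at this
  rw [div_eq_div_iff hb hb', this]

theorem hasValueAt_algebraMap (a : PhasePoly N) :
    HasValueAt (algebraMap (PhasePoly N) (PhaseField N) a) q p
      (MvPolynomial.eval (Sum.elim q p) a) :=
  ⟨a, 1, by simp, by simp, by simp⟩

theorem hasValueAt_const (c : ℂ) : HasValueAt (algebraMap ℂ (PhaseField N) c) q p c := by
  have h := hasValueAt_algebraMap (q := q) (p := p) (MvPolynomial.C c)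
  rw [MvPolynomial.eval_C] at h
  rwa [IsScalarTower.algebraMap_apply ℂ (PhasePoly N) (PhaseField N)]

theorem hasValueAt_one : HasValueAt (1 : PhaseField N) q p 1 := by
  simpa using hasValueAt_const (q := q) (p := p) 1

theorem hasValueAt_q (k : Params N) (i : Fin N) : HasValueAt ((genericState k).q i) q p (q i) := by
  have h := hasValueAt_algebraMap (q := q) (p := p) (MvPolynomial.X (Sum.inl i))
  rwa [MvPolynomial.eval_X, Sum.elim_inl] at h

theorem hasValueAt_p (k : Params N) (i : Fin N) : HasValueAt ((genericState k).p i) q p (p i) := by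
  have h := hasValueAt_algebraMap (q := q) (p := p) (MvPolynomial.X (Sum.inr i))
  rwa [MvPolynomial.eval_X, Sum.elim_inr] at h

theorem HasValueAt.add (h : HasValueAt r q p v) (h' : HasValueAt r' q p v') :
    HasValueAt (r + r') q p (v + v') := by
  obtain ⟨a, b, hb, rfl, rfl⟩ := h
  obtain ⟨a', b', hb', rfl, rfl⟩ := h'
  refine ⟨a * b' + b * a', b * b', by simp [hb, hb'], ?_, ?_⟩
  · rw [div_add_div _ _ (algebraMap_ne_zero_of_eval_ne_zero hb) (algebraMap_ne_zero_of_eval_ne_zero hb')]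
    simp only [map_add, map_mul]
  · rw [div_add_div _ _ hb hb']
    simp only [map_add, map_mul]

theorem HasValueAt.mul (h : HasValueAt r q p v) (h' : HasValueAt r' q p v') :
    HasValueAt (r * r') q p (v * v') := by
  obtain ⟨a, b, hb, rfl, rfl⟩ := h
  obtain ⟨a', b', hb', rfl, rfl⟩ := h'
  refine ⟨a * a', b * b', by simp [hb, hb'], ?_, ?_⟩
  · rw [div_mul_div_comm]
    simp only [map_mul]
  · rw [div_mul_div_comm]
    simp only [map_mul]

theorem HasValueAt.neg (h : HasValueAt r q p v) : HasValueAt (-r) q p (-v) := by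
  obtain ⟨a, b, hb, rfl, rfl⟩ := h
  exact ⟨-a, b, hb, by rw [map_neg]; exact (neg_div _ _).symm,
    by rw [map_neg]; exact (neg_div _ _).symm⟩

theorem HasValueAt.sub (h : HasValueAt r q p v) (h' : HasValueAt r' q p v') :
    HasValueAt (r - r') q p (v - v') := by
  rw [sub_eq_add_neg, sub_eq_add_neg]
  exact h.add h'.neg

theorem HasValueAt.inv (h : HasValueAt r q p v) (hv : v ≠ 0) : HasValueAt r⁻¹ q p v⁻¹ := by
  obtain ⟨a, b, hb, rfl, rfl⟩ := h
  refine ⟨b, a, fun h0 => hv (by rw [h0, zero_div]), by rw [inv_div], by rw [inv_div]⟩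

theorem HasValueAt.div (h : HasValueAt r q p v) (h' : HasValueAt r' q p v') (hv : v' ≠ 0) :
    HasValueAt (r / r') q p (v / v') := by
  rw [div_eq_mul_inv, div_eq_mul_inv]
  exact h.mul (h'.inv hv)

theorem HasValueAt.sum {f : Fin N → PhaseField N} {g : Fin N → ℂ} (t : Finset (Fin N))
    (h : ∀ j, HasValueAt (f j) q p (g j)) : HasValueAt (∑ j ∈ t, f j) q p (∑ j ∈ t, g j) := by
  induction t using Finset.induction_on with
  | empty => simpa using hasValueAt_const (q := q) (p := p) 0
  | insert a t ha ih =>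
    rw [Finset.sum_insert ha, Finset.sum_insert ha]
    exact (h a).add ih

theorem HasValueAt.ne_zero (h : HasValueAt r q p v) (hv : v ≠ 0) : r ≠ 0 := by
  rintro rfl
  exact hv (h.unique (by simpa using hasValueAt_const (q := q) (p := p) 0))

theorem hasValueAt_two : HasValueAt (2 : PhaseField N) q p 2 := by
  rw [← one_add_one_eq_two, ← one_add_one_eq_two]
  exact hasValueAt_one.add hasValueAt_one

variable (k : Params N)

theorem hasValueAt_sum_q : HasValueAt (∑ j, (genericState k).q j) q p (∑ j, q j) :=
  HasValueAt.sum _ fun j => hasValueAt_q k j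

theorem hasValueAt_sum_qp :
    HasValueAt (∑ j, (genericState k).q j * (genericState k).p j) q p (∑ j, q j * p j) :=
  HasValueAt.sum _ fun j => (hasValueAt_q k j).mul (hasValueAt_p k j)

theorem hasValueAt_mul_sub (j : Fin N) : HasValueAt ((genericState k).q j * (genericState k).p j
    - algebraMap ℂ (PhaseField N) (k.θ j)) q p (q j * p j - k.θ j) :=
  ((hasValueAt_q k j).mul (hasValueAt_p k j)).sub (hasValueAt_const _)

theorem hasValueAt_tauDen :
    HasValueAt (tauDen (genericState k)) q p (tauDen (⟨k, q, p⟩ : State N ℂ)) :=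
  ((hasValueAt_const _).add (hasValueAt_sum_qp k)).mul
    ((hasValueAt_const _).add (hasValueAt_sum_qp k))

theorem hasValueAt_sum_p_mul :
    HasValueAt (∑ j, (genericState k).p j * ((genericState k).q j * (genericState k).p j
      - algebraMap ℂ (PhaseField N) (k.θ j))) q p (∑ j, p j * (q j * p j - k.θ j)) :=
  HasValueAt.sum _ fun j => (hasValueAt_p k j).mul (hasValueAt_mul_sub k j)

theorem hasValueAt_todaPoly :
    HasValueAt (todaPoly (genericState k)) q p (todaPoly (⟨k, q, p⟩ : State N ℂ)) :=
  ((((hasValueAt_sum_q k).sub hasValueAt_one).mul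
    ((hasValueAt_tauDen k).sub (hasValueAt_sum_p_mul k))).neg).sub (hasValueAt_const _)

theorem hasValueAt_todaPolyDeriv {s : Fin N → ℂ} (i : Fin N) (hs : s i ≠ 0) :
    HasValueAt (todaPolyDeriv s i (genericState k)) q p
      (todaPolyDeriv s i (⟨k, q, p⟩ : State N ℂ)) := by
  have hA : HasValueAt (∑ j, (genericState k).q j - 1) q p (∑ j, q j - 1) :=
    (hasValueAt_sum_q k).sub hasValueAt_one
  exact ((((hA.mul ((hasValueAt_two.mul ((hasValueAt_q k i).mul (hasValueAt_p k i))).sub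
    (hasValueAt_const _))).sub ((hasValueAt_const _).mul (hasValueAt_q k i))).mul
    ((hasValueAt_tauDen k).sub (hasValueAt_sum_p_mul k))).sub
    (((hasValueAt_const _).mul hA).mul
      ((hasValueAt_p k i).mul (hasValueAt_mul_sub k i)))).div (hasValueAt_const _) hs

theorem hasValueAt_ham {s : Fin N → ℂ} (hs : Admissible s) (i : Fin N) :
    HasValueAt (ham k s i (genericState k).q (genericState k).p) q p (ham k s i q p) := by
  rw [ham_eq, ham_eq]
  have hu := fun j => (hasValueAt_p (q := q) (p := p) k j).mul (hasValueAt_mul_sub k j)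
  have he := fun j => (hasValueAt_q (q := q) (p := p) k j).mul (hasValueAt_p k j)
  have hw := fun j => hasValueAt_mul_sub (q := q) (p := p) k j
  refine HasValueAt.div ?_ (hasValueAt_const _)
    (mul_ne_zero (hs.ne_zero i) (sub_ne_zero.mpr (hs.ne_one i)))
  refine (((((hasValueAt_q k i).mul (hasValueAt_tauDen k)).add ((hasValueAt_const _).mul
    (hu i))).sub (HasValueAt.sum _ fun j => ?_)).sub (((hasValueAt_const _).add
      hasValueAt_one).mul ((hw i).mul (he i)))).add ((hasValueAt_const _).mul (he i))
  exact (((hasValueAt_const _).mul ((hasValueAt_q k i).mul (hu j))).add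
    ((hasValueAt_const _).mul ((hasValueAt_q k j).mul (hu i)))).add
    ((hasValueAt_const _).mul (((he j).mul (hw i)).add ((he i).mul (hw j))))

end Values

/-! ### The generic point lies in the domains of `l` and `l⁻¹`. -/

section Generic

/-- The second difference at `-1, 0, 1` recovers `a`. -/
theorem exists_quadratic_ne_zero {a : ℂ} (ha : a ≠ 0) (b c : ℂ) :
    ∃ t : ℂ, a * t ^ 2 + b * t + c ≠ 0 := by
  by_contra! h
  refine ha ?_
  linear_combination (h 1 + h (-1)) / 2 - h 0

variable {N : ℕ}

theorem tauDen_RthetaAllFun_Rinf_R0Fun {K : Type*} [Field K] [Algebra ℂ K] {s : Fin N → ℂ}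
    (hs : Admissible s) (x : State N K)
    (hB : ∑ j, x.q j / algebraMap ℂ K (s j) - 1 ≠ 0) (hq : ∀ j, x.q j ≠ 0) :
    tauDen (RthetaAllFun (Rinf N K (R0Fun s x))) =
      (algebraMap ℂ K (x.par.α + x.par.κinf) + ∑ j, x.q j * x.p j
        - algebraMap ℂ K x.par.κ0 / (∑ j, x.q j / algebraMap ℂ K (s j) - 1)) *
      (algebraMap ℂ K x.par.α + ∑ j, x.q j * x.p j
        - algebraMap ℂ K x.par.κ0 / (∑ j, x.q j / algebraMap ℂ K (s j) - 1)) := by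
  have hα : (RthetaAllFun (Rinf N K (R0Fun s x))).par.α =
      x.par.α + x.par.κ0 + x.par.κinf + ∑ j, x.par.θ j := by
    simp only [Params.α, RthetaAllFun, Rinf, R0Fun, PartialEquiv.coe_mk, Finset.sum_neg_distrib]
    ring
  have hκ : (RthetaAllFun (Rinf N K (R0Fun s x))).par.κinf = -x.par.κinf := rfl
  have hE : ∑ j, (RthetaAllFun (Rinf N K (R0Fun s x))).q j *
      (RthetaAllFun (Rinf N K (R0Fun s x))).p j =
      ∑ j, x.q j * x.p j - algebraMap ℂ K x.par.κ0
        - algebraMap ℂ K x.par.κ0 / (∑ j, x.q j / algebraMap ℂ K (s j) - 1)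
        - ∑ j, algebraMap ℂ K (x.par.θ j) := by
    have h : ∀ j, (RthetaAllFun (Rinf N K (R0Fun s x))).q j *
        (RthetaAllFun (Rinf N K (R0Fun s x))).p j = x.q j * x.p j
        - algebraMap ℂ K x.par.κ0 / (∑ j, x.q j / algebraMap ℂ K (s j) - 1) *
          (x.q j / algebraMap ℂ K (s j)) - algebraMap ℂ K (x.par.θ j) := fun j => by
      have h1 := hq j
      have h2 := hs.algebraMap_ne_zero (K := K) j
      simp only [RthetaAllFun, Rinf, R0Fun, PartialEquiv.coe_mk]
      field_simp
    simp only [h, Finset.sum_sub_distrib, ← Finset.mul_sum]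
    field_simp
    ring
  simp only [tauDen, hE, hα, hκ, map_add, map_sum, map_neg]
  ring

variable {s : Fin N → ℂ} (k : Params N)

theorem hasValueAt_sum_q_div {q p : Fin N → ℂ} (hs : Admissible s) :
    HasValueAt (∑ j, (genericState k).q j / algebraMap ℂ (PhaseField N) (s j) - 1) q p
      (∑ j, q j / s j - 1) :=
  (HasValueAt.sum _ fun j => (hasValueAt_q k j).div (hasValueAt_const _) (hs.ne_zero j)).sub
    hasValueAt_one

theorem sum_q_div_sub_one_ne_zero (hs : Admissible s) :
    ∑ j, (genericState k).q j / algebraMap ℂ (PhaseField N) (s j) - 1 ≠ 0 :=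
  (hasValueAt_sum_q_div k hs (q := 0) (p := 0)).ne_zero (by simp)

theorem sum_q_sub_one_ne_zero : ∑ j, (genericState k).q j - 1 ≠ 0 :=
  ((hasValueAt_sum_q k (q := 0) (p := 0)).sub hasValueAt_one).ne_zero (by simp)

theorem genericState_q_ne_zero (j : Fin N) : (genericState k).q j ≠ 0 :=
  (hasValueAt_q k j (q := 1) (p := 0)).ne_zero (by simp)

theorem hasValueAt_R0Fun_p {q p : Fin N → ℂ} (hs : Admissible s) (hB : ∑ j, q j / s j - 1 ≠ 0)
    (j : Fin N) : HasValueAt ((R0Fun s (genericState k)).p j) q p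
      (p j - k.κ0 / (s j * (∑ j, q j / s j - 1))) :=
  (hasValueAt_p k j).sub ((hasValueAt_const _).div
    ((hasValueAt_const _).mul (hasValueAt_sum_q_div k hs)) (mul_ne_zero (hs.ne_zero j) hB))

theorem hasValueAt_R1Fun_p {q p : Fin N → ℂ} (hA : ∑ j, q j - 1 ≠ 0)
    (j : Fin N) : HasValueAt ((R1Fun (genericState k)).p j) q p
      (p j - k.κ1 / (∑ j, q j - 1)) :=
  (hasValueAt_p k j).sub ((hasValueAt_const _).div
    ((hasValueAt_sum_q k).sub hasValueAt_one) hA)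

theorem hasValueAt_tauDen_R0Fun {q p : Fin N → ℂ} (hs : Admissible s)
    (hB : ∑ j, q j / s j - 1 ≠ 0) :
    HasValueAt (tauDen (RthetaAllFun (Rinf N (PhaseField N) (R0Fun s (genericState k))))) q p
      ((k.α + k.κinf + ∑ j, q j * p j - k.κ0 / (∑ j, q j / s j - 1)) *
        (k.α + ∑ j, q j * p j - k.κ0 / (∑ j, q j / s j - 1))) := by
  rw [tauDen_RthetaAllFun_Rinf_R0Fun hs _ (sum_q_div_sub_one_ne_zero k hs)
    (genericState_q_ne_zero k)]
  have h := (hasValueAt_const k.κ0).div (hasValueAt_sum_q_div (q := q) (p := p) k hs) hB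
  exact (((hasValueAt_const _).add (hasValueAt_sum_qp k)).sub h).mul
    (((hasValueAt_const _).add (hasValueAt_sum_qp k)).sub h)

/-- A rational function is nonzero as soon as it has a nonzero value somewhere, so each denominator
is tested at a convenient point. The index `i` guarantees `N ≥ 1`; for `N = 0` the denominator of
`R_τ` is a constant that may vanish. -/
theorem genericState_mem_shift_source (hs : Admissible s) (i : Fin N) :
    genericState k ∈ (shift (PhaseField N) s).source := by
  set x := genericState k with hx
  have hq : ∀ j, x.q j ≠ 0 := genericState_q_ne_zero k
  have hp : ∀ j, (R0Fun s x).p j ≠ 0 := fun j =>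
    (hasValueAt_R0Fun_p k hs (q := 0) (p := fun j => 1 - k.κ0 / s j) (by simp) j).ne_zero
      (by simp [div_neg])
  set y := RthetaAllFun (Rinf N (PhaseField N) (R0Fun s x)) with hy
  have hw : ∀ j, y.q j * y.p j - algebraMap ℂ (PhaseField N) (y.par.θ j) =
      x.q j * (R0Fun s x).p j := fun j => by
    have h : y.q j * y.p j - algebraMap ℂ (PhaseField N) (y.par.θ j) =
      x.q j * ((R0Fun s x).p j - algebraMap ℂ (PhaseField N) (x.par.θ j) / x.q j)
        - algebraMap ℂ (PhaseField N) (-x.par.θ j) := rfl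
    have := hq j
    rw [h, map_neg]
    field_simp
    ring
  -- At `q = 2 s_i e_i` the denominator of `R_{κ₀}` is `1`, and one free parameter `ρ` in `p` makes
  -- the remaining conditions quadratic in `ρ`.
  have hpoint : ∑ j, (Pi.single i (2 * s i) : Fin N → ℂ) j / s j - 1 = 1 := by
    have := hs.ne_zero i
    rw [Finset.sum_eq_single i (fun j _ hj => by simp [hj]) (by simp)]
    simp only [Pi.single_eq_same]
    field_simp
    ring
  have hpair : ∀ f : Fin N → ℂ, ∑ j, (Pi.single i (2 * s i) : Fin N → ℂ) j * f j =
      2 * s i * f i := fun f => by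
    rw [Finset.sum_eq_single i (fun j _ hj => by simp [hj]) (by simp)]
    simp
  have hD : tauDen y ≠ 0 := by
    obtain ⟨ρ, hρ⟩ := exists_quadratic_ne_zero (a := 4) (by norm_num)
      (2 * (k.α + k.κinf - k.κ0) + 2 * (k.α - k.κ0)) ((k.α + k.κinf - k.κ0) * (k.α - k.κ0))
    refine (hasValueAt_tauDen_R0Fun k hs (q := Pi.single i (2 * s i)) (p := fun j => ρ / s j)
      (by rw [hpoint]; exact one_ne_zero)).ne_zero ?_
    rw [hpoint, hpair]
    have := hs.ne_zero i
    convert hρ using 1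
    field_simp
    ring
  refine (mem_shift_source s x).mpr
    ⟨⟨hs.ne_zero, sum_q_div_sub_one_ne_zero k hs⟩, hq, ⟨hs.ne_zero, hD, fun j => ?_⟩, ?_⟩
  · rw [hw]
    exact mul_ne_zero (hq j) (hp j)
  · have hQ : ∀ j, (RtauFun s y).q j = algebraMap ℂ (PhaseField N) (s j) * ((R0Fun s x).p j *
        (x.q j * (R0Fun s x).p j - algebraMap ℂ (PhaseField N) (k.θ j))) / tauDen y := fun j => by
      have h : (RtauFun s y).q j = algebraMap ℂ (PhaseField N) (s j) *
        ((R0Fun s x).p j - algebraMap ℂ (PhaseField N) (k.θ j) / x.q j) *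
        (y.q j * y.p j - algebraMap ℂ (PhaseField N) (y.par.θ j)) / tauDen y := rfl
      have := hq j
      rw [h, hw]
      congr 1
      field_simp
    change ∑ j, (RtauFun s y).q j - 1 ≠ 0
    simp only [hQ, ← Finset.sum_div]
    rw [div_sub_one hD]
    refine div_ne_zero ?_ hD
    obtain ⟨ρ, hρ⟩ := exists_quadratic_ne_zero (a := -2) (by norm_num)
      (-k.θ i - 2 * (k.α + k.κinf + k.κ0) - 2 * (k.α + k.κ0))
      (-((k.α + k.κinf + k.κ0) * (k.α + k.κ0)))
    have hB : ∑ j, (Pi.single i (2 * s i) : Fin N → ℂ) j / s j - 1 ≠ 0 := by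
      rw [hpoint]; exact one_ne_zero
    -- The summand `κ₀ / s_j` offsets the translation, so the translated momentum is `ρ / s_i` at
    -- index `i` and `0` elsewhere. The leading coefficient is `2 - 4 = -2`.
    have hP := hasValueAt_R0Fun_p k hs (q := Pi.single i (2 * s i))
      (p := fun j => k.κ0 / s j + (Pi.single i (ρ / s i) : Fin N → ℂ) j) hB
    have hval := (HasValueAt.sum Finset.univ fun j => (hasValueAt_const (s j)).mul
      ((hP j).mul (((hasValueAt_q k j).mul (hP j)).sub (hasValueAt_const (k.θ j))))).sub
      (hasValueAt_tauDen_R0Fun k hs hB)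
    refine hval.ne_zero ?_
    rw [hpoint, hpair, Finset.sum_eq_single i (fun j _ hj => by simp [hj]) (by simp)]
    have := hs.ne_zero i
    simp only [Pi.single_eq_same, mul_one, add_sub_cancel_left]
    convert hρ using 1
    field_simp
    ring

theorem R1Fun_genericState_mem_RtauDom (hs : Admissible s) (i : Fin N) :
    R1Fun (genericState k) ∈ RtauDom (K := PhaseField N) s := by
  have hsum : ∀ m : Fin N, ∑ j, (Pi.single m 2 : Fin N → ℂ) j - 1 = 1 := fun m => by
    rw [Finset.sum_pi_single' m]
    norm_num
  have hsum_ne : ∀ m : Fin N, ∑ j, (Pi.single m 2 : Fin N → ℂ) j - 1 ≠ 0 := fun m => by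
    rw [hsum]; exact one_ne_zero
  refine ⟨hs.ne_zero, ?_, fun m => ?_⟩
  · rw [tauDen_R1Fun _ (sum_q_sub_one_ne_zero k)]
    obtain ⟨ρ, hρ⟩ := exists_quadratic_ne_zero (a := 4) (by norm_num)
      (2 * (k.α + k.κinf - k.κ1) + 2 * (k.α - k.κ1)) ((k.α + k.κinf - k.κ1) * (k.α - k.κ1))
    have h := (hasValueAt_const k.κ1).div ((hasValueAt_sum_q (q := Pi.single i 2)
      (p := fun _ => ρ) k).sub hasValueAt_one) (hsum_ne i)
    refine ((((hasValueAt_const k.α).add (hasValueAt_sum_qp k)).sub h).mul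
      (((hasValueAt_const (k.α + k.κinf)).add (hasValueAt_sum_qp k)).sub h)).ne_zero ?_
    rw [hsum, Finset.sum_eq_single i (fun j _ hj => by simp [hj]) (by simp)]
    simp only [Pi.single_eq_same]
    convert hρ using 1
    ring
  -- Here `q = 2 e_m`, and `p` is chosen so that the translated momentum is `(θ_m + 1) / 2`; the
  -- value is `1`.
  · refine (((hasValueAt_q k m).mul (hasValueAt_R1Fun_p k (q := Pi.single m 2)
      (p := fun _ => k.κ1 + (k.θ m + 1) / 2) (hsum_ne m) m)).sub
      (hasValueAt_const (k.θ m))).ne_zero ?_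
    rw [hsum]
    simp only [Pi.single_eq_same]
    ring_nf
    exact one_ne_zero

theorem R1Fun_genericState_p_ne_zero (j : Fin N) : (R1Fun (genericState k)).p j ≠ 0 :=
  (hasValueAt_R1Fun_p k (q := 0) (p := fun _ => 1 - k.κ1) (by simp) j).ne_zero
    (by simp [div_neg])

end Generic

end

end Garnier

theorem proposition2p1 {N : ℕ} (k : Garnier.Params N) (U : Set (Fin N → ℂ))
    (q p : (Fin N → ℂ) → Fin N → ℂ) (hsol : Garnier.IsSolution k U q p) :
    (∀ i, DifferentiableOn ℂ (Garnier.hamAlong k q p i) U) ∧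
    DifferentiableOn ℂ (Garnier.todaF k q p) U ∧
    ∀ s ∈ U, Garnier.todaF k q p s ≠ 0 → ∀ (i : Fin N) (Hplus Hminus : ℂ),
      Garnier.HasValueAt (Garnier.hamPlus k s i) (q s) (p s) Hplus →
      Garnier.HasValueAt (Garnier.hamMinus k s i) (q s) (p s) Hminus →
      Hplus - 2 * Garnier.hamAlong k q p i s + Hminus =
        Garnier.pd i (Garnier.todaF k q p) s / Garnier.todaF k q p s := by
  refine ⟨fun i s hs => (hsol.differentiableAt_hamAlong hs i).differentiableWithinAt,
    hsol.differentiableOn_todaF, fun s hs hF i Hplus Hminus hplus hminus => ?_⟩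
  have hadm := hsol.admissible hs
  rw [hsol.todaF_eq hs] at hF ⊢
  rw [hsol.pd_todaF hs]
  -- Since `F(s) ≠ 0` is a value of `todaPoly`, this polynomial is nonzero in `ℂ(q, p)`. Both sides
  -- of the resulting identity are then evaluated at `(q(s), p(s))`.
  have hgen := Garnier.ham_shift_sub_add hadm i (Garnier.genericState_mem_shift_source k hadm i)
    (Garnier.sum_q_sub_one_ne_zero k) (Garnier.R1Fun_genericState_mem_RtauDom k hadm i)
    (Garnier.R1Fun_genericState_p_ne_zero k) ((Garnier.hasValueAt_todaPoly k).ne_zero hF)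
  have hleft := (hplus.sub (Garnier.hasValueAt_two.mul (Garnier.hasValueAt_ham k hadm i))).add
    hminus
  have hright := (Garnier.hasValueAt_todaPolyDeriv (q := q s) (p := p s) k i
    (hadm.ne_zero i)).div (Garnier.hasValueAt_todaPoly k) hF
  rw [← hgen] at hright
  exact hleft.unique hright
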